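/- Let $M$ be an $n$-dimensional smooth manifold. An asymmetric norm on a real vector space $V$ is a function $N:V\to[0,\infty)$ with $N(y)=0$ iff $y=0$, $N(\lambda y)=\lambda N(y)$ for $\lambda>0$, and $N(y+z)\le N(y)+N(z)$. Let $F:TM\to[0,\infty)$ be a $C^0$-Finsler structure, that is, a continuous function which is an asymmetric norm on every tangent space, and let $\check F:TM\to[0,\infty)$ be a Finsler structure, that is, $\check F$ is smooth on $TM\setminus 0$, positively homogeneous of degree one on each tangent space, and the Hessian of $\check F^2(x,\cdot)$ at every $y\ne0$ is positive definite. Suppose that $F$ is strongly convex with respect to $\check F$: $$F^2(x,z)\ \ge\ F^2(x,y)+\alpha(z-y)+\check F^2(x,z-y)$$ for all $x\in M$, $y,z\in T_xM$ and all $\alpha\in T_x^*M$ in the subdifferential of $F^2(x,\cdot)$ at $y$. Let $U\subset M$ be open, and suppose that there are a smooth local trivialization $\tau:TU\to U\times\mathbb R^n$ of the tangent bundle and a coordinate system $\phi:U\to\mathbb R^n$ such that $F_{\tau_\phi}=F\circ\tau_\phi^{-1}:\phi(U)\times\mathbb R^n\to\mathbb R$, where $\tau_\phi=(\phi\times\mathrm{id})\circ\tau$,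 is a horizontally $C^2$ family of asymmetric norms (it is continuous, each $F_{\tau_\phi}(x,\cdot)$ is an asymmetric norm, the partial derivatives $\partial F_{\tau_\phi}/\partial x^i$ exist and are continuous on $\phi(U)\times\mathbb R^n$, and the second partial derivatives $\partial^2F_{\tau_\phi}/\partial x^i\partial x^j$ exist and are continuous on $\phi(U)\times(\mathbb R^n\setminus\{0\})$), and such that the horizontal differential $d_hF^2_{\tau_\phi}=\frac{\partial F^2_{\tau_\phi}}{\partial x^i}dx^i:\phi(U)\times\mathbb R^n\to\mathbb R^{n*}$ is locally Lipschitz. A control system on a coordinate domain $(W,\psi)$ of $M$ is a family $X_u$, $u\in S^{n-1}\subset\mathbb R^n$, of $C^1$ vector fields on $W$ such that $u\mapsto X_u(x)$ is a homeomorphism from $S^{n-1}$ onto $\{y\in T_xM: F(x,y)=1\}$ for every $x\in W$, and such that the components of $X_u(x)$ in the natural coordinates and their first partial derivatives in $x$ are continuous in $(x,u)$. $F$ is of Pontryagin type at a point if there is a control system on some coordinate neighborhood of it. Given a control system, put $H_u(x,\alpha)=\alpha(X_u(x))$, let $\vec H_u$ be its Hamiltonian vector field on $T^*W$, defined by $\omega(\cdot,\vec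 H_u)=dH_u$ with $\omega=d\theta$ and $\theta$ the tautological $1$-form, and for $(x,\alpha)\in T^*W\setminus0$ define the extended geodesic field $$\mathcal E(x,\alpha)=\{\vec H_u(x,\alpha)\;:\;u\in S^{n-1},\ H_u(x,\alpha)=\max_{v\in S^{n-1}}H_v(x,\alpha)\}.$$ Then $F$ is of Pontryagin type at every point of $U$, and the extended geodesic field $\mathcal E$ of $(U,F)$ is a locally Lipschitz vector field on the slit cotangent bundle $T^*U\setminus0$: there is a locally Lipschitz vector field $\xi$ on $T^*U\setminus 0$ such that $\mathcal E(x,\alpha)=\{\xi(x,\alpha)\}$ for every control system on a coordinate domain $W$ of $M$ and every $(x,\alpha)\in T^*(U\cap W)\setminus 0$. -/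

import Mathlib

open Bundle Set Topology
open scoped Manifold ContDiff

noncomputable section

/-- An asymmetric norm on a real vector space. -/
structure IsAsymmetricNorm {V : Type*} [AddCommGroup V] [Module ℝ V] (N : V → ℝ) : Prop where
  nonneg : ∀ y, 0 ≤ N y
  eq_zero_iff : ∀ y, N y = 0 ↔ y = 0
  pos_homogeneous : ∀ (c : ℝ) (y : V), 0 < c → N (c • y) = c * N y
  triangle : ∀ y z, N (y + z) ≤ N y + N z

/-! ### Families of asymmetric norms over an open subset of `ℝⁿ` -/

/-- The horizontal differential `d_h F (x, y)`: the differential at `x` of `F (·, y)`. -/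
def horizontalDifferential {n : ℕ} {W : Type*} [NormedAddCommGroup W] [NormedSpace ℝ W]
    (F : EuclideanSpace ℝ (Fin n) × EuclideanSpace ℝ (Fin n) → W)
    (q : EuclideanSpace ℝ (Fin n) × EuclideanSpace ℝ (Fin n)) :
    EuclideanSpace ℝ (Fin n) →L[ℝ] W :=
  fderiv ℝ (fun x => F (x, q.2)) q.1

/-- `F : D × ℝⁿ → ℝ`, with `D` open, is a horizontally `C¹` family of asymmetric norms.
The partial derivatives `∂F/∂xⁱ` exist and are continuous on `D × ℝⁿ` exactly when every `F (·, y)`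
is differentiable on `D` and the horizontal differential is continuous on `D × ℝⁿ`. -/
structure IsHorizontallyC1Family {n : ℕ}
    (F : EuclideanSpace ℝ (Fin n) × EuclideanSpace ℝ (Fin n) → ℝ)
    (D : Set (EuclideanSpace ℝ (Fin n))) : Prop where
  isOpen : IsOpen D
  continuousOn : ContinuousOn F (D ×ˢ univ)
  isAsymmetricNorm : ∀ x ∈ D, IsAsymmetricNorm (fun y => F (x, y))
  differentiableOn : ∀ y, DifferentiableOn ℝ (fun x => F (x, y)) D
  continuousOn_differential : ContinuousOn (horizontalDifferential F) (D ×ˢ univ)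

/-- `F : D × ℝⁿ → ℝ` is a horizontally `C²` family of asymmetric norms: it is horizontally `C¹`,
and the second partial derivatives `∂²F/∂xⁱ∂xʲ` exist and are continuous on `D × (ℝⁿ \ 0)`. -/
structure IsHorizontallyC2Family {n : ℕ}
    (F : EuclideanSpace ℝ (Fin n) × EuclideanSpace ℝ (Fin n) → ℝ)
    (D : Set (EuclideanSpace ℝ (Fin n))) : Prop extends IsHorizontallyC1Family F D where
  differentiableOn_differential :
    ∀ y, y ≠ 0 → DifferentiableOn ℝ (fun x => horizontalDifferential F (x, y)) D
  continuousOn_second :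
    ContinuousOn (horizontalDifferential (horizontalDifferential F)) (D ×ˢ {0}ᶜ)

/-! ### `C⁰`-Finsler structures and strong convexity -/

section Manifold

variable {n : ℕ} {M : Type*} [TopologicalSpace M] [ChartedSpace (EuclideanSpace ℝ (Fin n)) M]
  [IsManifold (𝓡 n) ∞ M]

/-- A `C⁰`-Finsler structure on `M`. -/
structure IsC0FinslerStructure (F : TangentBundle (𝓡 n) M → ℝ) : Prop where
  continuous : Continuous F
  isAsymmetricNorm : ∀ x : M, IsAsymmetricNorm (fun y : TangentSpace (𝓡 n) x => F ⟨x, y⟩)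

/-- A (smooth) Finsler structure on `M`: nonnegative, smooth on the slit tangent bundle, positively
homogeneous, with positive definite fundamental tensor.  The number `d²/dt² F²(x, y + t v)` at
`t = 0` is the Hessian of `F² (x, ·)` at `y`, evaluated at `(v, v)`. -/
structure IsFinslerStructure (F : TangentBundle (𝓡 n) M → ℝ) : Prop where
  nonneg : ∀ p, 0 ≤ F p
  contMDiffOn : ContMDiffOn (𝓡 n).tangent 𝓘(ℝ, ℝ) ∞ F {p | p.2 ≠ 0}
  pos_homogeneous : ∀ (x : M) (c : ℝ) (y : TangentSpace (𝓡 n) x), 0 < c →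
    F ⟨x, c • y⟩ = c * F ⟨x, y⟩
  hessian_pos : ∀ (x : M) (y v : TangentSpace (𝓡 n) x), y ≠ 0 → v ≠ 0 →
    0 < iteratedDeriv 2 (fun t : ℝ => F ⟨x, y + t • v⟩ ^ 2) 0

/-- The subdifferential of `F² (x, ·)` at `y`. -/
def subdifferentialSq (F : TangentBundle (𝓡 n) M → ℝ) (x : M) (y : TangentSpace (𝓡 n) x) :
    Set (TangentSpace (𝓡 n) x →L[ℝ] ℝ) :=
  {a | ∀ z : TangentSpace (𝓡 n) x, F ⟨x, y⟩ ^ 2 + a (z - y) ≤ F ⟨x, z⟩ ^ 2}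

/-- `F` is strongly convex with respect to `G`. -/
def IsStronglyConvexWrt (F G : TangentBundle (𝓡 n) M → ℝ) : Prop :=
  ∀ (x : M) (y z : TangentSpace (𝓡 n) x), ∀ a ∈ subdifferentialSq F x y,
    F ⟨x, y⟩ ^ 2 + a (z - y) + G ⟨x, z - y⟩ ^ 2 ≤ F ⟨x, z⟩ ^ 2

/-! ### Control systems and Pontryagin type -/

/-- The component functions `(z, u) ↦ (y¹(z, u), …, yⁿ(z, u))` of the vector fields `X_u` in the
natural coordinates of the tangent bundle induced by the coordinate system `φ`. -/
def componentsInChart (φ : OpenPartialHomeomorph M (EuclideanSpace ℝ (Fin n)))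
    (X : Metric.sphere (0 : EuclideanSpace ℝ (Fin n)) 1 → (x : M) → TangentSpace (𝓡 n) x)
    (q : EuclideanSpace ℝ (Fin n) × Metric.sphere (0 : EuclideanSpace ℝ (Fin n)) 1) :
    EuclideanSpace ℝ (Fin n) :=
  mvfderiv (𝓡 n) φ (φ.symm q.1) (X q.2 (φ.symm q.1))

/-- `X_u`, `u ∈ Sⁿ⁻¹`, is a family of `C¹` unit vector fields on the domain of the coordinate
system `φ` which satisfies the three conditions in the definition of Pontryagin type. Only the
values of `X_u` on the domain of `φ` matter. -/
structure IsControlSystem (F : TangentBundle (𝓡 n) M → ℝ)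
    (φ : OpenPartialHomeomorph M (EuclideanSpace ℝ (Fin n)))
    (X : Metric.sphere (0 : EuclideanSpace ℝ (Fin n)) 1 → (x : M) → TangentSpace (𝓡 n) x) :
    Prop where
  mem_maximalAtlas : φ ∈ IsManifold.maximalAtlas (𝓡 n) ∞ M
  contDiffOn : ∀ u, ContDiffOn ℝ 1 (fun z => componentsInChart φ X (z, u)) φ.target
  /-- `u ↦ X_u(x)` is a homeomorphism of the Euclidean unit sphere onto `S_F[x, 0, 1]`. -/
  isEmbedding : ∀ x ∈ φ.source, IsEmbedding (fun u => X u x)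
  range_eq : ∀ x ∈ φ.source,
    range (fun u => X u x) = {y : TangentSpace (𝓡 n) x | F ⟨x, y⟩ = 1}
  continuousOn_components : ContinuousOn (componentsInChart φ X) (φ.target ×ˢ univ)
  continuousOn_derivatives :
    ContinuousOn
      (fun q : EuclideanSpace ℝ (Fin n) × Metric.sphere (0 : EuclideanSpace ℝ (Fin n)) 1 =>
        fderiv ℝ (fun z => componentsInChart φ X (z, q.2)) q.1) (φ.target ×ˢ univ)

/-- `F` is of Pontryagin type at `p`. -/
def IsPontryaginTypeAt (F : TangentBundle (𝓡 n) M → ℝ) (p : M) : Prop :=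
  ∃ (φ : OpenPartialHomeomorph M (EuclideanSpace ℝ (Fin n)))
    (X : Metric.sphere (0 : EuclideanSpace ℝ (Fin n)) 1 → (x : M) → TangentSpace (𝓡 n) x),
    p ∈ φ.source ∧ IsControlSystem F φ X

/-! ### The cotangent bundle and Hamiltonian vectors -/

variable (n M) in
/-- The cotangent bundle `T*M`; a point is a pair `⟨x, a⟩` with `a` a covector at `x`. -/
abbrev CotangentBundle : Type _ :=
  TotalSpace (EuclideanSpace ℝ (Fin n) →L[ℝ] ℝ)
    (fun x : M => TangentSpace (𝓡 n) x →L[ℝ] Bundle.Trivial M ℝ x)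

variable (n) in
/-- The model space `ℝⁿ × (ℝⁿ)*` of the manifold `T*M`. -/
abbrev CotModel : Type :=
  EuclideanSpace ℝ (Fin n) × (EuclideanSpace ℝ (Fin n) →L[ℝ] ℝ)

variable (n) in
/-- The model (without boundary) of the manifold `T*M`. -/
abbrev cotI : ModelWithCorners ℝ (CotModel n)
    (ModelProd (EuclideanSpace ℝ (Fin n)) (EuclideanSpace ℝ (Fin n) →L[ℝ] ℝ)) :=
  (𝓡 n).prod 𝓘(ℝ, EuclideanSpace ℝ (Fin n) →L[ℝ] ℝ)

/-- The part over `U` of the slit cotangent bundle, `T*U \ 0`. -/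
def slitCotangentOver (U : Set M) : Set (CotangentBundle n M) :=
  {p | p.1 ∈ U ∧ p.2 ≠ 0}

/-- The tautological `1`-form `θ` on `T*M`: `θ_p (v) = p (dπ_p v)`. -/
def tautologicalForm (p : CotangentBundle n M) : TangentSpace (cotI n) p →L[ℝ] ℝ :=
  p.2.comp (mfderiv (cotI n) (𝓡 n) (fun q : CotangentBundle n M => q.1) p)

/-- The tautological form read in the chart of `T*M` at `p`, as a differential `1`-form on an open
subset of the model space: the pullback of `θ` by the inverse of the chart. -/
def tautologicalFormInChart (p : CotangentBundle n M) (z : CotModel n) :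
    CotModel n [⋀^Fin 1]→L[ℝ] ℝ :=
  ContinuousAlternatingMap.ofSubsingleton ℝ (CotModel n) ℝ (0 : Fin 1)
    ((tautologicalForm ((extChartAt (cotI n) p).symm z)).comp
      ((mfderiv 𝓘(ℝ, CotModel n) (cotI n) (extChartAt (cotI n) p).symm z).comp
        (NormedSpace.fromTangentSpace z).symm.toContinuousLinearMap))

/-- The canonical symplectic form `ω = dθ` on `T*M`. -/
def symplecticForm (p : CotangentBundle n M) (v w : TangentSpace (cotI n) p) : ℝ :=
  extDeriv (tautologicalFormInChart p) (extChartAt (cotI n) p p)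
    ![mvfderiv (cotI n) (extChartAt (cotI n) p) p v, mvfderiv (cotI n) (extChartAt (cotI n) p) p w]

/-- `ξ` is the value at `p` of the Hamiltonian vector field of `H`: `ω_p (·, ξ) = dH_p`. -/
def IsHamiltonianVector (H : CotangentBundle n M → ℝ) (p : CotangentBundle n M)
    (ξ : TangentSpace (cotI n) p) : Prop :=
  ∀ v : TangentSpace (cotI n) p,
    symplecticForm p v ξ = mvfderiv (cotI n) H p v

/-- The Hamiltonian `H_u (x, a) = a (X_u (x))`. -/
def controlHamiltonian
    (X : Metric.sphere (0 : EuclideanSpace ℝ (Fin n)) 1 → (x : M) → TangentSpace (𝓡 n) x)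
    (u : Metric.sphere (0 : EuclideanSpace ℝ (Fin n)) 1) (p : CotangentBundle n M) : ℝ :=
  p.2 (X u p.1)

/-- The extended geodesic field of the control system `X`: the set of the Hamiltonian vectors at
`p = (x, a)` of those `H_u` for which `u` maximizes `v ↦ H_v (x, a)`. -/
def extendedGeodesicField
    (X : Metric.sphere (0 : EuclideanSpace ℝ (Fin n)) 1 → (x : M) → TangentSpace (𝓡 n) x)
    (p : CotangentBundle n M) : Set (TangentSpace (cotI n) p) :=
  {ξ | ∃ u, (∀ v, controlHamiltonian X v p ≤ controlHamiltonian X u p) ∧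
    IsHamiltonianVector (controlHamiltonian X u) p ξ}

/-- The vector field `ξ` is locally Lipschitz on the open set `O ⊆ T*M`: around every point of `O`,
its representation in the chart of `T*M` at that point is Lipschitz. -/
def IsLocallyLipschitzVectorFieldOn (ξ : (p : CotangentBundle n M) → TangentSpace (cotI n) p)
    (O : Set (CotangentBundle n M)) : Prop :=
  ∀ p ∈ O, ∃ K, ∃ V ∈ 𝓝 (extChartAt (cotI n) p p),
    LipschitzOnWith K
      (fun z : CotModel n =>
        mvfderiv (cotI n) (extChartAt (cotI n) p) ((extChartAt (cotI n) p).symm z)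
          (ξ ((extChartAt (cotI n) p).symm z))) V

/-! ### Local trivializations -/

/-- `τ : TU → U × ℝⁿ` is a (smooth, fiberwise linear) local trivialization of the tangent bundle
over `U`. -/
structure IsSmoothLocalTrivialization
    (τ : Trivialization (EuclideanSpace ℝ (Fin n))
      (π (EuclideanSpace ℝ (Fin n)) (TangentSpace (𝓡 n) : M → Type _)))
    (U : Set M) : Prop where
  baseSet_eq : τ.baseSet = U
  isLinear : τ.IsLinear ℝ
  contMDiffOn : ContMDiffOn (𝓡 n).tangent ((𝓡 n).prod (𝓡 n)) ∞ τ τ.source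
  contMDiffOn_symm : ContMDiffOn ((𝓡 n).prod (𝓡 n)) (𝓡 n).tangent ∞
    τ.toOpenPartialHomeomorph.symm τ.target

/-- `F` read in the coordinates `τ_φ = (φ × id) ∘ τ` of `TU`, that is `F ∘ τ_φ⁻¹`; it is considered
on `φ(U) × ℝⁿ` only. -/
def inTrivialization (F : TangentBundle (𝓡 n) M → ℝ)
    (τ : Trivialization (EuclideanSpace ℝ (Fin n))
      (π (EuclideanSpace ℝ (Fin n)) (TangentSpace (𝓡 n) : M → Type _)))
    (φ : OpenPartialHomeomorph M (EuclideanSpace ℝ (Fin n)))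
    (q : EuclideanSpace ℝ (Fin n) × EuclideanSpace ℝ (Fin n)) : ℝ :=
  F (τ.toOpenPartialHomeomorph.symm (φ.symm q.1, q.2))

end Manifold

end

/-!
Strong convexity of `F²` is what makes the maximizer of a covector on the unit sphere of `F` unique
and Lipschitz; an envelope principle then removes all dependence on the control system.

Near a point of `U`, in the coordinates given by `φ` and `τ`, `F` becomes a family `f (x, ·)` of
asymmetric norms whose squares are strongly convex with a modulus `c` that does not depend on `x`,
because a Finsler structure dominates a multiple of the Euclidean norm on compact sets
(`IsStronglyConvexWrt.exists_isStronglyConvexNorm`). For a covector `b`, the function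
`f (x, ·)² / 2 - b` therefore has exactly one minimizer `y (x, b)`, the Legendre point of `b`. If
`b ≠ 0`, then `f (x, y)` is the dual norm of `b`, and `y / f (x, y)` is the only point at which `b`
attains its maximum over the unit sphere. Adding the strong convexity inequalities at two Legendre
points and estimating the resulting second difference of `f²` by the Lipschitz constant of its
horizontal differential shows that `y` is locally Lipschitz in `(x, b)`
(`lipschitzNear_legendrePoint`).

The symplectic form is `dβ ∧ dq` in every natural chart of `T*M` (`symplecticForm_apply`), so the
Hamiltonian vector of `H_u = β Y`, with `Y` the components of `X_u`, is `(Y, - β ∘ DY)`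
(`isHamiltonianVector_iff`). At a maximizing `u` the velocity `Y` is the normalized Legendre point,
whatever the control system is. For the second component, let `y q` be the coordinates of `X_u` in
the frame `τ`: it is a field of unit vectors that at the base point maximizes `b`, with dual norm
`m`. The function `b (y q) + m / 2 * (f² (x, y q) - f² (x₀, y q))` has a local maximum at the base
point, and so `b ∘ Dy = - m / 2 * d_h f²` there (`envelope`). Hence the extended geodesic field
consists of a single vector, with an expression in terms of the Legendre point, the smooth frame
and `d_h f²` only (`mem_extendedGeodesicField_iff`), and this expression is locally Lipschitz
(`lipschitzNear_geodesicFieldCoord`).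

Finally, the vector fields with `τ`-coordinates `u / f (x, u)`, for `u` in the Euclidean unit
sphere, form a control system on `U` (`isControlSystem_radialControl`).
-/

/-! ### Strongly convex asymmetric norms and their Legendre transform -/

section StronglyConvex

variable {V : Type*} [NormedAddCommGroup V] [NormedSpace ℝ V]

/-- A continuous asymmetric norm `N` whose square is strongly convex with modulus `c`: every
subgradient inequality for `N²` improves by `c ‖z - y‖²`. -/
structure IsStronglyConvexNorm (c : ℝ) (N : V → ℝ) : Prop extends IsAsymmetricNorm N where
  continuous : Continuous N
  modulus_pos : 0 < c
  strong_convex : ∀ (y z : V) (a : V →L[ℝ] ℝ), (∀ w, N y ^ 2 + a (w - y) ≤ N w ^ 2) →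
    N y ^ 2 + a (z - y) + c * ‖z - y‖ ^ 2 ≤ N z ^ 2

/-- `y` minimizes `N² / 2 - b`, that is, `b` is a subgradient of `N² / 2` at `y`. -/
def IsLegendrePoint (N : V → ℝ) (b : V →L[ℝ] ℝ) (y : V) : Prop :=
  ∀ z, N y ^ 2 / 2 - b y ≤ N z ^ 2 / 2 - b z

/-- The Legendre transform of `N² / 2`: a minimizer of `N² / 2 - b`, whenever there is one. -/
noncomputable def legendrePoint (N : V → ℝ) (b : V →L[ℝ] ℝ) : V :=
  Classical.epsilon (IsLegendrePoint N b)

namespace IsStronglyConvexNorm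

variable {c : ℝ} {N : V → ℝ} {b : V →L[ℝ] ℝ} {y : V}

lemma map_zero (hN : IsStronglyConvexNorm c N) : N 0 = 0 := (hN.eq_zero_iff 0).2 rfl

lemma mul_sq_norm_le (hN : IsStronglyConvexNorm c N) (z : V) : c * ‖z‖ ^ 2 ≤ N z ^ 2 := by
  have h := hN.strong_convex 0 z 0 (fun w => by simp [hN.map_zero]; positivity)
  simpa [hN.map_zero] using h

/-- At a Legendre point the minimality of `N² / 2 - b` is quadratic, since `2 b` is a subgradient
of `N²` there. -/
lemma strong_min (hN : IsStronglyConvexNorm c N) (hy : IsLegendrePoint N b y) (z : V) :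
    N y ^ 2 + 2 * b (z - y) + c * ‖z - y‖ ^ 2 ≤ N z ^ 2 := by
  have h := hN.strong_convex y z ((2 : ℝ) • b) (fun w => by
    have := hy w
    simp only [_root_.smul_apply, map_sub, smul_eq_mul]
    linarith)
  simpa using h

lemma isLegendrePoint_unique (hN : IsStronglyConvexNorm c N) (hy : IsLegendrePoint N b y) {z : V}
    (hz : IsLegendrePoint N b z) : z = y := by
  have h1 := hN.strong_min hy z
  have h2 := hz y
  have h3 : c * ‖z - y‖ ^ 2 ≤ 0 := by
    rw [map_sub] at h1; linarith
  have h4 : ‖z - y‖ ^ 2 ≤ 0 := by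
    by_contra hcon
    have := mul_pos hN.modulus_pos (not_le.1 hcon)
    linarith
  have h5 : ‖z - y‖ = 0 := by
    have := sq_nonneg ‖z - y‖
    exact pow_eq_zero_iff (two_ne_zero) |>.1 (le_antisymm h4 this)
  exact sub_eq_zero.1 (norm_eq_zero.1 h5)

/-- Euler's relation, obtained by minimizing along the ray through `y`. -/
lemma apply_eq_sq (hN : IsStronglyConvexNorm c N) (hy : IsLegendrePoint N b y) :
    b y = N y ^ 2 := by
  have key : ∀ t : ℝ, 0 < t → (t - 1) * b y ≤ (t ^ 2 - 1) / 2 * N y ^ 2 := fun t ht => by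
    have := hy (t • y)
    rw [hN.pos_homogeneous t y ht, map_smul, smul_eq_mul] at this
    nlinarith
  have hloc : IsLocalMin (fun t : ℝ => (t ^ 2 - 1) / 2 * N y ^ 2 - (t - 1) * b y) 1 := by
    filter_upwards [lt_mem_nhds (zero_lt_one' ℝ)] with t ht
    have := key t ht
    norm_num at this ⊢
    linarith
  have hd : HasDerivAt (fun t : ℝ => (t ^ 2 - 1) / 2 * N y ^ 2 - (t - 1) * b y)
      (2 * 1 / 2 * N y ^ 2 - 1 * b y) 1 := by
    have h1 : HasDerivAt (fun t : ℝ => t ^ 2) (2 * 1) 1 := by simpa using hasDerivAt_pow 2 (1 : ℝ)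
    exact (((h1.sub_const 1).div_const 2).mul_const _).sub
      (((hasDerivAt_id (1 : ℝ)).sub_const 1).mul_const _)
  have := hloc.hasDerivAt_eq_zero hd
  linarith

lemma pos_of_ne_zero (hN : IsStronglyConvexNorm c N) (hy : IsLegendrePoint N b y) (hb : b ≠ 0) :
    0 < N y := by
  obtain ⟨z, hz⟩ : ∃ z, b z ≠ 0 := by
    by_contra! h
    exact hb (ContinuousLinearMap.ext h)
  refine lt_of_le_of_ne (hN.nonneg y) fun h0 => ?_
  have hy0 : y = 0 := (hN.eq_zero_iff y).1 h0.symm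
  subst hy0
  -- otherwise `N² / 2 - b` would be nonnegative, but it is negative close to `0` along `±z`
  have key : ∀ w, b w ≤ 0 := fun w => by
    by_contra hw
    rw [not_le] at hw
    have h1 : ∀ t : ℝ, 0 < t → b w ≤ t * (N w ^ 2 / 2) := fun t ht => by
      have := hy (t • w)
      rw [hN.pos_homogeneous t w ht, map_smul, smul_eq_mul, hN.map_zero, _root_.map_zero] at this
      have h2 : t * b w ≤ t * (t * (N w ^ 2 / 2)) := by nlinarith
      exact le_of_mul_le_mul_left h2 ht
    have h2 : 0 < N w ^ 2 + 1 := by positivity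
    have h3 := h1 (b w / (N w ^ 2 + 1)) (by positivity)
    rw [div_mul_eq_mul_div, le_div_iff₀ h2] at h3
    nlinarith [mul_nonneg hw.le (sq_nonneg (N w))]
  have h1 := key z
  have h2 := key (-z)
  rw [map_neg] at h2
  exact hz (le_antisymm h1 (by linarith))

lemma norm_le (hN : IsStronglyConvexNorm c N) (hy : IsLegendrePoint N b y) :
    ‖y‖ ≤ ‖b‖ / c := by
  have h1 := hN.mul_sq_norm_le y
  rw [← hN.apply_eq_sq hy] at h1
  have h2 : b y ≤ ‖b‖ * ‖y‖ := (le_abs_self _).trans (b.le_opNorm y)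
  rw [le_div_iff₀ hN.modulus_pos]
  rcases (norm_nonneg y).eq_or_lt with h | h
  · rw [← h]; simp
  · have : ‖y‖ * c * ‖y‖ ≤ ‖b‖ * ‖y‖ := by nlinarith
    exact le_of_mul_le_mul_right this h

/-- The value of `N` at the Legendre point is the dual norm of `b`. -/
lemma apply_le (hN : IsStronglyConvexNorm c N) (hy : IsLegendrePoint N b y) (hb : b ≠ 0) (v : V) :
    b v ≤ N y * N v := by
  have hm := hN.pos_of_ne_zero hy hb
  rcases (hN.nonneg v).eq_or_lt with h | h
  · rw [(hN.eq_zero_iff v).1 h.symm]; simp [hN.map_zero]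
  · have h1 := hy ((N y / N v) • v)
    rw [hN.pos_homogeneous _ v (by positivity), map_smul, smul_eq_mul, hN.apply_eq_sq hy,
      div_mul_cancel₀ _ h.ne', div_mul_eq_mul_div] at h1
    have h2 : N y * b v / N v ≤ N y ^ 2 := by linarith
    rw [div_le_iff₀ h] at h2
    have : N y * b v ≤ N y * (N y * N v) := by nlinarith
    exact le_of_mul_le_mul_left this hm

/-- The only point at which `b` can attain its maximum over the unit sphere of `N` is the
normalized Legendre point. -/
lemma eq_inv_smul_of_isMax (hN : IsStronglyConvexNorm c N) (hy : IsLegendrePoint N b y)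
    (hb : b ≠ 0) {v : V} (hv : N v = 1) (hmax : ∀ w, N w = 1 → b w ≤ b v) :
    v = (N y)⁻¹ • y := by
  have hm := hN.pos_of_ne_zero hy hb
  have h1 := hmax ((N y)⁻¹ • y) (by
    rw [hN.pos_homogeneous _ _ (by positivity), inv_mul_cancel₀ hm.ne'])
  rw [map_smul, smul_eq_mul, hN.apply_eq_sq hy] at h1
  have h2 : N y ≤ b v := by
    calc N y = (N y)⁻¹ * N y ^ 2 := by field_simp
      _ ≤ b v := h1
  have h3 : IsLegendrePoint N b (N y • v) := fun z => by
    have := hy z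
    rw [hN.pos_homogeneous _ _ hm, map_smul, smul_eq_mul, hv]
    rw [hN.apply_eq_sq hy] at this
    nlinarith
  exact (eq_inv_smul_iff₀ hm.ne').2 (hN.isLegendrePoint_unique hy h3)

lemma norm_inv_smul (hN : IsStronglyConvexNorm c N) (hy : IsLegendrePoint N b y)
    (hb : b ≠ 0) : N ((N y)⁻¹ • y) = 1 := by
  have hm := hN.pos_of_ne_zero hy hb
  rw [hN.pos_homogeneous _ _ (by positivity), inv_mul_cancel₀ hm.ne']

lemma apply_inv_smul (hN : IsStronglyConvexNorm c N) (hy : IsLegendrePoint N b y)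
    (hb : b ≠ 0) : b ((N y)⁻¹ • y) = N y := by
  have hm := hN.pos_of_ne_zero hy hb
  rw [map_smul, smul_eq_mul, hN.apply_eq_sq hy]
  field_simp

lemma exists_isLegendrePoint [FiniteDimensional ℝ V] (hN : IsStronglyConvexNorm c N)
    (b : V →L[ℝ] ℝ) : ∃ y, IsLegendrePoint N b y := by
  have : ProperSpace V := FiniteDimensional.proper ℝ V
  have hc := hN.modulus_pos
  have hcont : Continuous fun y => N y ^ 2 / 2 - b y :=
    ((hN.continuous.pow 2).div_const 2).sub b.continuous
  refine hcont.exists_forall_le' 0 ?_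
  have : ∀ᶠ y in Filter.cocompact V, 2 * ‖b‖ / c < ‖y‖ :=
    tendsto_norm_cocompact_atTop.eventually_gt_atTop _
  filter_upwards [this] with y hy
  rw [div_lt_iff₀ hc] at hy
  have h1 := hN.mul_sq_norm_le y
  have h2 : b y ≤ ‖b‖ * ‖y‖ := (le_abs_self _).trans (b.le_opNorm y)
  rw [hN.map_zero, _root_.map_zero]
  nlinarith [norm_nonneg y]

lemma isLegendrePoint_legendrePoint [FiniteDimensional ℝ V] (hN : IsStronglyConvexNorm c N)
    (b : V →L[ℝ] ℝ) : IsLegendrePoint N b (legendrePoint N b) :=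
  Classical.epsilon_spec (hN.exists_isLegendrePoint b)

end IsStronglyConvexNorm

end StronglyConvex

/-! ### Functions that are Lipschitz near a point -/

section LipschitzNear

variable {α β γ : Type*} [PseudoMetricSpace α] [PseudoMetricSpace β] [PseudoMetricSpace γ]

/-- `f` is Lipschitz on some neighborhood of `x`. -/
def LipschitzNear (f : α → β) (x : α) : Prop := ∃ K, ∃ V ∈ 𝓝 x, LipschitzOnWith K f V

lemma LipschitzNear.continuousAt {f : α → β} {x : α} (hf : LipschitzNear f x) :
    ContinuousAt f x := by
  obtain ⟨K, V, hV, h⟩ := hf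
  exact h.continuousOn.continuousAt hV

lemma LipschitzNear.comp {g : β → γ} {f : α → β} {x : α} (hg : LipschitzNear g (f x))
    (hf : LipschitzNear f x) : LipschitzNear (fun z => g (f z)) x := by
  have hc := hf.continuousAt
  obtain ⟨K, V, hV, h⟩ := hf
  obtain ⟨K', V', hV', h'⟩ := hg
  exact ⟨K' * K, V ∩ f ⁻¹' V', Filter.inter_mem hV (hc hV'),
    h'.comp (h.mono inter_subset_left) fun z hz => hz.2⟩

lemma LipschitzNear.prodMk {g : α → γ} {f : α → β} {x : α} (hf : LipschitzNear f x)
    (hg : LipschitzNear g x) : LipschitzNear (fun z => (f z, g z)) x := by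
  obtain ⟨K, V, hV, h⟩ := hf
  obtain ⟨K', V', hV', h'⟩ := hg
  exact ⟨max K K', V ∩ V', Filter.inter_mem hV hV',
    (h.mono inter_subset_left).prodMk (h'.mono inter_subset_right)⟩

lemma lipschitzNear_id (x : α) : LipschitzNear (fun z => z) x :=
  ⟨1, univ, Filter.univ_mem, LipschitzWith.id.lipschitzOnWith⟩

lemma LipschitzNear.congr {f g : α → β} {x : α} (hf : LipschitzNear f x) (h : f =ᶠ[𝓝 x] g) :
    LipschitzNear g x := by
  obtain ⟨K, V, hV, h'⟩ := hf
  refine ⟨K, V ∩ {z | f z = g z}, Filter.inter_mem hV h, fun z hz w hw => ?_⟩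
  rw [← hz.2, ← hw.2]
  exact h' hz.1 hw.1

lemma LocallyLipschitzOn.lipschitzNear {f : α → β} {s : Set α} (hf : LocallyLipschitzOn s f)
    {x : α} (hx : s ∈ 𝓝 x) : LipschitzNear f x := by
  obtain ⟨K, V, hV, h⟩ := hf (mem_of_mem_nhds hx)
  exact ⟨K, V, by rwa [nhdsWithin_eq_nhds.2 hx] at hV, h⟩

lemma ContDiffAt.lipschitzNear {E F : Type*} [NormedAddCommGroup E] [NormedSpace ℝ E]
    [NormedAddCommGroup F] [NormedSpace ℝ F] {f : E → F} {x : E} (hf : ContDiffAt ℝ 1 f x) :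
    LipschitzNear f x := hf.exists_lipschitzOnWith

end LipschitzNear

/-! ### Horizontally differentiable families -/

section Family

variable {n : ℕ}

local notation "𝓔" => EuclideanSpace ℝ (Fin n)

lemma hasFDerivAt_horizontal {g : 𝓔 × 𝓔 → ℝ} {D : Set 𝓔} (hD : IsOpen D)
    (hdiff : ∀ y, DifferentiableOn ℝ (fun x => g (x, y)) D) {x : 𝓔} (hx : x ∈ D) (y : 𝓔) :
    HasFDerivAt (fun x => g (x, y)) (horizontalDifferential g (x, y)) x :=
  ((hdiff y).differentiableAt (hD.mem_nhds hx)).hasFDerivAt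

/-- The Legendre point `y(x, b)` of a horizontally differentiable family of uniformly strongly
convex norms depends in a Lipschitz way on `(x, b)`. For two parameters, the sum of the two strong
convexity inequalities at the respective Legendre points bounds `2 c ‖y₁ - y₂‖²` by a second
difference of `f²`, which the mean value inequality and the Lipschitz bound for the horizontal
differential control by `‖x₁ - x₂‖ ‖y₁ - y₂‖`, plus `2 (b₁ - b₂) (y₁ - y₂)`. -/
lemma lipschitzNear_legendrePoint {f : 𝓔 × 𝓔 → ℝ} {D : Set 𝓔} (hD : IsOpen D)
    (hdiff : ∀ y, DifferentiableOn ℝ (fun x => f (x, y) ^ 2) D)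
    (hLip : LocallyLipschitzOn (D ×ˢ univ) (horizontalDifferential (fun q => f q ^ 2)))
    {x₀ : 𝓔} (hx₀ : x₀ ∈ D) {c : ℝ}
    (hc : ∀ᶠ x in 𝓝 x₀, IsStronglyConvexNorm c (fun y => f (x, y))) (b₀ : 𝓔 →L[ℝ] ℝ) :
    LipschitzNear (fun q : 𝓔 × (𝓔 →L[ℝ] ℝ) => legendrePoint (fun y => f (q.1, y)) q.2)
      (x₀, b₀) := by
  have hcpos : 0 < c := hc.self_of_nhds.modulus_pos
  obtain ⟨r, hr, hball⟩ := Metric.nhds_basis_closedBall.mem_iff.1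
    (Filter.inter_mem (hD.mem_nhds hx₀) hc)
  -- all Legendre points for `b` in the unit ball around `b₀` have norm at most `R`
  set R := (‖b₀‖ + 1) / c
  obtain ⟨K, hK⟩ := LocallyLipschitzOn.exists_lipschitzOnWith_of_compact
    ((isCompact_closedBall x₀ r).prod (isCompact_closedBall (0 : 𝓔) R))
    (hLip.mono (prod_mono (fun x hx => (hball hx).1) (subset_univ _)))
  set ys : 𝓔 × (𝓔 →L[ℝ] ℝ) → 𝓔 := fun q => legendrePoint (fun y => f (q.1, y)) q.2
  have hspec : ∀ q : 𝓔 × (𝓔 →L[ℝ] ℝ), q.1 ∈ Metric.closedBall x₀ r →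
      IsLegendrePoint (fun y => f (q.1, y)) q.2 (ys q) := fun q hq =>
    (hball hq).2.isLegendrePoint_legendrePoint q.2
  have hnorm : ∀ q : 𝓔 × (𝓔 →L[ℝ] ℝ), q.1 ∈ Metric.closedBall x₀ r →
      q.2 ∈ Metric.closedBall b₀ 1 → ys q ∈ Metric.closedBall (0 : 𝓔) R := fun q hq hq2 => by
    have h1 := (hball hq).2.norm_le (hspec q hq)
    have h2 : ‖q.2‖ ≤ ‖b₀‖ + 1 := by
      have h3 : ‖q.2 - b₀‖ ≤ 1 := by simpa [dist_eq_norm] using hq2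
      have h4 := norm_le_norm_add_norm_sub' q.2 b₀
      linarith
    rw [mem_closedBall_zero_iff]
    exact h1.trans (div_le_div_of_nonneg_right h2 hcpos.le)
  have hL : 0 ≤ ((K : ℝ) + 2) / (2 * c) := by positivity
  refine ⟨(((K : ℝ) + 2) / (2 * c)).toNNReal, Metric.closedBall x₀ r ×ˢ Metric.closedBall b₀ 1,
    prod_mem_nhds (Metric.closedBall_mem_nhds _ hr) (Metric.closedBall_mem_nhds _ one_pos),
    LipschitzOnWith.of_dist_le_mul ?_⟩
  rintro ⟨x₁, b₁⟩ ⟨hx₁, hb₁⟩ ⟨x₂, b₂⟩ ⟨hx₂, hb₂⟩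
  simp only [Real.coe_toNNReal _ hL] at hx₁ hx₂ hb₁ hb₂ ⊢
  have s1 := (hball hx₁).2.strong_min (hspec (x₁, b₁) hx₁) (ys (x₂, b₂))
  have s2 := (hball hx₂).2.strong_min (hspec (x₂, b₂) hx₂) (ys (x₁, b₁))
  have n1 := hnorm (x₁, b₁) hx₁ hb₁
  have n2 := hnorm (x₂, b₂) hx₂ hb₂
  change dist (ys (x₁, b₁)) (ys (x₂, b₂)) ≤ _
  generalize ys (x₁, b₁) = y₁ at *
  generalize ys (x₂, b₂) = y₂ at *
  -- the second difference of `f²`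
  have hmv : ‖(f (x₁, y₂) ^ 2 - f (x₁, y₁) ^ 2) - (f (x₂, y₂) ^ 2 - f (x₂, y₁) ^ 2)‖
      ≤ K * ‖y₂ - y₁‖ * ‖x₁ - x₂‖ := by
    refine Convex.norm_image_sub_le_of_norm_hasFDerivWithin_le
      (f := fun x => f (x, y₂) ^ 2 - f (x, y₁) ^ 2)
      (f' := fun x => horizontalDifferential (fun q => f q ^ 2) (x, y₂) -
        horizontalDifferential (fun q => f q ^ 2) (x, y₁))
      (fun x hx => ?_) (fun x hx => ?_) (convex_closedBall x₀ r) hx₂ hx₁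
    · exact ((hasFDerivAt_horizontal (g := fun q => f q ^ 2) hD hdiff (hball hx).1 y₂).sub
        (hasFDerivAt_horizontal (g := fun q => f q ^ 2) hD hdiff (hball hx).1 y₁)).hasFDerivWithinAt
    · have := hK.dist_le_mul (x, y₂) ⟨hx, n2⟩ (x, y₁) ⟨hx, n1⟩
      rwa [dist_eq_norm, Prod.dist_eq, dist_self, max_eq_right dist_nonneg, dist_eq_norm] at this
  rw [Real.norm_eq_abs] at hmv
  have hmv' := (abs_le.1 hmv).2
  have hb : |(b₂ - b₁) (y₂ - y₁)| ≤ ‖b₂ - b₁‖ * ‖y₂ - y₁‖ := (b₂ - b₁).le_opNorm _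
  have hb' := (abs_le.1 hb).2
  have hflip : b₂ (y₁ - y₂) = - b₂ (y₂ - y₁) := by rw [← map_neg, neg_sub]
  rw [hflip, norm_sub_rev y₁ y₂] at s2
  rw [_root_.sub_apply] at hb'
  have hd : dist ((x₁, b₁) : 𝓔 × (𝓔 →L[ℝ] ℝ)) (x₂, b₂) = max ‖x₁ - x₂‖ ‖b₂ - b₁‖ := by
    rw [Prod.dist_eq, dist_eq_norm, dist_eq_norm, norm_sub_rev b₁ b₂]
  rw [hd, dist_eq_norm, norm_sub_rev y₁ y₂, div_mul_eq_mul_div, le_div_iff₀ (by positivity)]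
  rcases (norm_nonneg (y₂ - y₁)).eq_or_lt with h0 | h0
  · rw [← h0, zero_mul]; positivity
  · refine le_of_mul_le_mul_right ?_ h0
    have e1 : ‖x₁ - x₂‖ ≤ max ‖x₁ - x₂‖ ‖b₂ - b₁‖ := le_max_left _ _
    have e2 : ‖b₂ - b₁‖ ≤ max ‖x₁ - x₂‖ ‖b₂ - b₁‖ := le_max_right _ _
    calc ‖y₂ - y₁‖ * (2 * c) * ‖y₂ - y₁‖
        ≤ K * ‖y₂ - y₁‖ * ‖x₁ - x₂‖ + 2 * (‖b₂ - b₁‖ * ‖y₂ - y₁‖) := by nlinarith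
      _ ≤ K * ‖y₂ - y₁‖ * max ‖x₁ - x₂‖ ‖b₂ - b₁‖
          + 2 * (max ‖x₁ - x₂‖ ‖b₂ - b₁‖ * ‖y₂ - y₁‖) := by gcongr
      _ = _ := by ring

variable {E' : Type*} [NormedAddCommGroup E'] [NormedSpace ℝ E']

/-- If `h = d_h g` is continuous, `q ↦ g (t q, y q) - g (t q₀, y q)` is differentiable at `q₀` as
soon as `t` is differentiable and `y` is continuous there. -/
lemma hasFDerivAt_sub_horizontal {g : 𝓔 × 𝓔 → ℝ} {D : Set 𝓔} (hD : IsOpen D)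
    (hdiff : ∀ y, DifferentiableOn ℝ (fun x => g (x, y)) D)
    (hcont : ContinuousOn (horizontalDifferential g) (D ×ˢ univ))
    {t : E' → 𝓔} {y : E' → 𝓔} {q₀ : E'} {t' : E' →L[ℝ] 𝓔} (ht : HasFDerivAt t t' q₀)
    (ht₀ : t q₀ ∈ D) (hy : ContinuousAt y q₀) :
    HasFDerivAt (fun q => g (t q, y q) - g (t q₀, y q))
      ((horizontalDifferential g (t q₀, y q₀)).comp t') q₀ := by
  set h₀ := horizontalDifferential g (t q₀, y q₀)
  have hlit : (fun q => g (t q, y q) - g (t q₀, y q) - h₀ (t q - t q₀)) =o[𝓝 q₀]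
      fun q => t q - t q₀ := by
    refine Asymptotics.isLittleO_iff.2 fun ε hε => ?_
    have hca : ContinuousAt (horizontalDifferential g) (t q₀, y q₀) :=
      hcont.continuousAt ((hD.prod isOpen_univ).mem_nhds ⟨ht₀, mem_univ _⟩)
    obtain ⟨r, hr, hball⟩ := Metric.nhds_basis_ball.mem_iff.1
      (Filter.inter_mem (hca (Metric.closedBall_mem_nhds h₀ hε))
        ((hD.prod isOpen_univ).mem_nhds ⟨ht₀, mem_univ (y q₀)⟩))
    filter_upwards [ht.continuousAt (Metric.ball_mem_nhds _ hr), hy (Metric.ball_mem_nhds _ hr)]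
      with q hq1 hq2
    have hmem : ∀ x ∈ Metric.ball (t q₀) r, (x, y q) ∈ Metric.ball (t q₀, y q₀) r := fun x hx => by
      rw [← ball_prod_same]; exact ⟨hx, hq2⟩
    refine Convex.norm_image_sub_le_of_norm_hasFDerivWithin_le' (f := fun x => g (x, y q))
      (f' := fun x => horizontalDifferential g (x, y q)) (s := Metric.ball (t q₀) r)
      (fun x hx => (hasFDerivAt_horizontal hD hdiff (hball (hmem x hx)).2.1 _).hasFDerivWithinAt)
      (fun x hx => ?_) (convex_ball _ _) (Metric.mem_ball_self hr) hq1
    have := (hball (hmem x hx)).1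
    rwa [mem_preimage, Metric.mem_closedBall, dist_eq_norm] at this
  have h1 : HasFDerivAt (fun q => h₀ (t q - t q₀)) (h₀.comp t') q₀ :=
    h₀.hasFDerivAt.comp q₀ (ht.sub_const (t q₀))
  have h2 : HasFDerivAt (fun q => g (t q, y q) - g (t q₀, y q) - h₀ (t q - t q₀))
      (0 : E' →L[ℝ] ℝ) q₀ := by
    refine HasFDerivAt.of_isLittleO ?_
    simpa using hlit.trans_isBigO ht.isBigO_sub
  rw [← zero_add (h₀.comp t')]
  exact (h2.add h1).congr_of_eventuallyEq (Filter.Eventually.of_forall fun q => by simp)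

/-- The envelope principle: if `y q` is a curve of unit vectors of `f (t q, ·)` which at `q₀`
maximizes the covector `b` over the unit sphere, then the derivative of `b ∘ y` at `q₀` depends
only on the horizontal differential of `f²`. The function
`b (y q) + m / 2 * (f² (t q, y q) - f² (t q₀, y q))`, with `m` the dual norm of `b`, is bounded by
`m`, with equality at `q₀`, so its derivative vanishes there. -/
lemma envelope {f : 𝓔 × 𝓔 → ℝ} {D : Set 𝓔} (hD : IsOpen D)
    (hdiff : ∀ y, DifferentiableOn ℝ (fun x => f (x, y) ^ 2) D)
    (hcont : ContinuousOn (horizontalDifferential (fun q => f q ^ 2)) (D ×ˢ univ))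
    {t : E' → 𝓔} {y : E' → 𝓔} {q₀ : E'} {t' y' : E' →L[ℝ] 𝓔} (ht : HasFDerivAt t t' q₀)
    (ht₀ : t q₀ ∈ D) (hy : HasFDerivAt y y' q₀) (hfy : ∀ᶠ q in 𝓝 q₀, f (t q, y q) = 1)
    {b : 𝓔 →L[ℝ] ℝ} {m : ℝ} (hm : 0 < m) (hdual : ∀ v, b v ≤ m * f (t q₀, v))
    (hmax : b (y q₀) = m) :
    b.comp y' = -(m / 2) • (horizontalDifferential (fun q => f q ^ 2) (t q₀, y q₀)).comp t' := by
  have hd := (b.hasFDerivAt.comp q₀ hy).add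
    ((hasFDerivAt_sub_horizontal (g := fun q => f q ^ 2) hD hdiff hcont ht ht₀
      hy.continuousAt).const_smul (m / 2))
  have hloc : IsLocalMax (⇑b ∘ y + (m / 2) • fun q => f (t q, y q) ^ 2 - f (t q₀, y q) ^ 2) q₀ := by
    filter_upwards [hfy] with q hq
    have h1 := hdual (y q)
    simp only [Pi.add_apply, Function.comp_apply, Pi.smul_apply, smul_eq_mul, hq, hmax, sub_self,
      mul_zero, add_zero]
    nlinarith [sq_nonneg (f (t q₀, y q) - 1)]
  have := hloc.hasFDerivAt_eq_zero hd
  rw [neg_smul]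
  exact eq_neg_of_add_eq_zero_left this

end Family

/-! ### Natural coordinates of the cotangent bundle -/

lemma Differentiable.ofSubsingleton {E V : Type*} [NormedAddCommGroup E] [NormedSpace ℝ E]
    [NormedAddCommGroup V] [NormedSpace ℝ V] {h : E → V →L[ℝ] ℝ} (hh : Differentiable ℝ h) :
    Differentiable ℝ
      (fun z => ContinuousAlternatingMap.ofSubsingleton ℝ V ℝ (0 : Fin 1) (h z)) :=
  (ContinuousAlternatingMap.ofSubsingletonLIE (𝕜 := ℝ) (E := V) (F := ℝ)
    (0 : Fin 1)).toContinuousLinearEquiv.differentiable.comp hh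

section Cotangent

variable {n : ℕ} {M : Type*} [TopologicalSpace M] [ChartedSpace (EuclideanSpace ℝ (Fin n)) M]
  [IsManifold (𝓡 n) ∞ M]

local notation "𝓔" => EuclideanSpace ℝ (Fin n)

lemma mem_extChartAt_cotangent_source {p₀ p : CotangentBundle n M} :
    p ∈ (extChartAt (cotI n) p₀).source ↔ p.1 ∈ (chartAt 𝓔 p₀.1).source := by
  rw [FiberBundle.extChartAt]
  simp only [PartialEquiv.trans_source, OpenPartialHomeomorph.toFun_eq_coe,
    Trivialization.coe_coe, PartialEquiv.prod_source, PartialEquiv.refl_source, mem_inter_iff,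
    mem_preimage, mem_prod, mem_univ, and_true, hom_trivializationAt_source, extChartAt_source,
    TangentBundle.trivializationAt_baseSet, Trivial.fiberBundle_trivializationAt',
    Trivial.trivialization_baseSet, inter_univ]
  exact and_self_iff

lemma extChartAt_cotangent_fst (p₀ p : CotangentBundle n M) :
    (extChartAt (cotI n) p₀ p).1 = chartAt 𝓔 p₀.1 p.1 := by
  rw [FiberBundle.extChartAt]
  rfl

/-- The second component of the chart of `T*M` is the coordinate expression of a covector: it takes
the value `p v` at the coordinate expression of the tangent vector `v`. -/
lemma extChartAt_cotangent_snd_apply (p₀ p : CotangentBundle n M)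
    (hp : p.1 ∈ (chartAt 𝓔 p₀.1).source) (v : TangentSpace (𝓡 n) p.1) :
    (extChartAt (cotI n) p₀ p).2 (mvfderiv (𝓡 n) (chartAt 𝓔 p₀.1) p.1 v) = p.2 v := by
  have h1 : (extChartAt (cotI n) p₀ p).2 =
      p.2.comp ((trivializationAt 𝓔 (TangentSpace (𝓡 n)) p₀.1).symmL ℝ p.1) := by
    rw [FiberBundle.extChartAt]
    ext w
    simp [hom_trivializationAt_apply, ContinuousLinearMap.inCoordinates]
  have h2 : mvfderiv (𝓡 n) (chartAt 𝓔 p₀.1) p.1 v =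
      (trivializationAt 𝓔 (TangentSpace (𝓡 n)) p₀.1).continuousLinearMapAt ℝ p.1 v := by
    rw [TangentBundle.continuousLinearMapAt_trivializationAt hp]
    rfl
  rw [h1, h2, ContinuousLinearMap.comp_apply]
  exact congrArg p.2 ((trivializationAt 𝓔 (TangentSpace (𝓡 n)) p₀.1).symmL_continuousLinearMapAt
    (R := ℝ) (b := p.1) hp v)

lemma contMDiff_cotangent_proj :
    ContMDiff (cotI n) (𝓡 n) ∞ (fun q : CotangentBundle n M => q.1) :=
  Bundle.contMDiff_proj _

lemma mdifferentiableAt_extChartAt_cotangent {p₀ p : CotangentBundle n M}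
    (hp : p ∈ (extChartAt (cotI n) p₀).source) :
    MDifferentiableAt (cotI n) 𝓘(ℝ, CotModel n) (extChartAt (cotI n) p₀) p :=
  mdifferentiableAt_extChartAt (by rwa [extChartAt_source] at hp)

lemma mdifferentiableAt_extChartAt_cotangent_symm {p₀ : CotangentBundle n M} {z : CotModel n}
    (hz : z ∈ (extChartAt (cotI n) p₀).target) :
    MDifferentiableAt 𝓘(ℝ, CotModel n) (cotI n) (extChartAt (cotI n) p₀).symm z := by
  have := mdifferentiableWithinAt_extChartAt_symm hz
  rwa [ModelWithCorners.Boundaryless.range_eq_univ, mdifferentiableWithinAt_univ] at this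

/-- In natural coordinates `(q, β)` the tautological form is `β dq`. -/
lemma tautologicalForm_apply {p₀ p : CotangentBundle n M}
    (hp : p ∈ (extChartAt (cotI n) p₀).source) (v : TangentSpace (cotI n) p) :
    tautologicalForm p v =
      (extChartAt (cotI n) p₀ p).2 (mvfderiv (cotI n) (extChartAt (cotI n) p₀) p v).1 := by
  have hp' := mem_extChartAt_cotangent_source.1 hp
  have hχ : MDifferentiableAt (𝓡 n) 𝓘(ℝ, 𝓔) (chartAt 𝓔 p₀.1) p.1 :=
    mdifferentiableAt_extChartAt (I := 𝓡 n) hp'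
  have hπ : MDifferentiableAt (cotI n) (𝓡 n) (fun q : CotangentBundle n M => q.1) p :=
    contMDiff_cotangent_proj.mdifferentiableAt (by simp)
  have h1 : HasMFDerivAt (cotI n) 𝓘(ℝ, 𝓔)
      (chartAt 𝓔 p₀.1 ∘ (fun q : CotangentBundle n M => q.1)) p
      ((mfderiv (𝓡 n) 𝓘(ℝ, 𝓔) (chartAt 𝓔 p₀.1) p.1).comp
        (mfderiv (cotI n) (𝓡 n) (fun q : CotangentBundle n M => q.1) p)) :=
    hχ.hasMFDerivAt.comp p hπ.hasMFDerivAt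
  have h2 : HasMFDerivAt (cotI n) 𝓘(ℝ, 𝓔) (Prod.fst ∘ extChartAt (cotI n) p₀) p
      ((ContinuousLinearMap.fst ℝ 𝓔 (𝓔 →L[ℝ] ℝ)).comp
        (mfderiv (cotI n) 𝓘(ℝ, CotModel n) (extChartAt (cotI n) p₀) p)) :=
    (hasFDerivAt_fst (𝕜 := ℝ) (E := 𝓔) (F := 𝓔 →L[ℝ] ℝ)).hasMFDerivAt.comp p
      (mdifferentiableAt_extChartAt_cotangent hp).hasMFDerivAt
  have heq : (chartAt 𝓔 p₀.1 ∘ (fun q : CotangentBundle n M => q.1)) =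
      Prod.fst ∘ extChartAt (cotI n) p₀ :=
    funext fun q => (extChartAt_cotangent_fst p₀ q).symm
  rw [heq] at h1
  have h3 := congrArg (fun L => L v) (hasMFDerivAt_unique h1 h2)
  rw [tautologicalForm, ContinuousLinearMap.comp_apply]
  refine (extChartAt_cotangent_snd_apply p₀ p hp' _).symm.trans ?_
  exact congrArg (extChartAt (cotI n) p₀ p).2 h3

variable (n) in
/-- The tautological form of the model space: `β dq` at `(q, β)`. -/
noncomputable def modelTautologicalForm (z : CotModel n) : CotModel n [⋀^Fin 1]→L[ℝ] ℝ :=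
  ContinuousAlternatingMap.ofSubsingleton ℝ (CotModel n) ℝ (0 : Fin 1)
    (z.2.comp (ContinuousLinearMap.fst ℝ 𝓔 (𝓔 →L[ℝ] ℝ)))

lemma differentiable_modelTautologicalForm : Differentiable ℝ (modelTautologicalForm n) := by
  have h : Differentiable ℝ fun z : CotModel n =>
      z.2.comp (ContinuousLinearMap.fst ℝ 𝓔 (𝓔 →L[ℝ] ℝ)) := by fun_prop
  exact h.ofSubsingleton

/-- In natural coordinates the symplectic form is `dβ ∧ dq`. -/
lemma extDeriv_modelTautologicalForm (z v w : CotModel n) :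
    extDeriv (modelTautologicalForm n) z ![v, w] = v.2 w.1 - w.2 v.1 := by
  have h : ∀ a b : CotModel n, fderiv ℝ (fun x : CotModel n => x.2 a.1) z b = b.2 a.1 :=
    fun a b => by
      have : HasFDerivAt (fun x : CotModel n => x.2 a.1)
        ((ContinuousLinearMap.apply ℝ ℝ a.1).comp (ContinuousLinearMap.snd ℝ 𝓔 (𝓔 →L[ℝ] ℝ))) z :=
        (ContinuousLinearMap.apply ℝ ℝ a.1).hasFDerivAt.comp z hasFDerivAt_snd
      rw [this.fderiv]
      rfl
  rw [extDeriv_apply (differentiable_modelTautologicalForm z)]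
  simp [Fin.sum_univ_two, modelTautologicalForm, Fin.removeNth, h, sub_eq_add_neg]

section ChartChange

variable {p₀ p : CotangentBundle n M}

lemma hasMFDerivAt_chartChange {z : CotModel n} (hz : z ∈ (extChartAt (cotI n) p).target)
    (hz₀ : (extChartAt (cotI n) p).symm z ∈ (extChartAt (cotI n) p₀).source) :
    HasMFDerivAt 𝓘(ℝ, CotModel n) 𝓘(ℝ, CotModel n)
      (extChartAt (cotI n) p₀ ∘ (extChartAt (cotI n) p).symm) z
      ((mfderiv (cotI n) 𝓘(ℝ, CotModel n) (extChartAt (cotI n) p₀)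
        ((extChartAt (cotI n) p).symm z)).comp
        (mfderiv 𝓘(ℝ, CotModel n) (cotI n) (extChartAt (cotI n) p).symm z)) :=
  (mdifferentiableAt_extChartAt_cotangent hz₀).hasMFDerivAt.comp z
    (mdifferentiableAt_extChartAt_cotangent_symm hz).hasMFDerivAt

lemma contDiffAt_chartChange {z : CotModel n} (hz : z ∈ (extChartAt (cotI n) p).target)
    (hz₀ : (extChartAt (cotI n) p).symm z ∈ (extChartAt (cotI n) p₀).source) :
    ContDiffAt ℝ 2 (extChartAt (cotI n) p₀ ∘ (extChartAt (cotI n) p).symm) z := by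
  have := contDiffWithinAt_ext_coord_change (n := 2) (I := cotI n) p₀ p (y := z)
    (by rw [PartialEquiv.trans_source]; exact ⟨hz, hz₀⟩)
  rwa [ModelWithCorners.Boundaryless.range_eq_univ, contDiffWithinAt_univ] at this

lemma tautologicalFormInChart_eq_pullback {z : CotModel n}
    (hz : z ∈ (extChartAt (cotI n) p).target)
    (hz₀ : (extChartAt (cotI n) p).symm z ∈ (extChartAt (cotI n) p₀).source) :
    tautologicalFormInChart p z =
      (modelTautologicalForm n ((extChartAt (cotI n) p₀ ∘ (extChartAt (cotI n) p).symm) z)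
        ).compContinuousLinearMap
        (fderiv ℝ (extChartAt (cotI n) p₀ ∘ (extChartAt (cotI n) p).symm) z) := by
  have h := hasMFDerivAt_unique (hasMFDerivAt_chartChange hz hz₀)
    ((contDiffAt_chartChange hz hz₀).differentiableAt (by simp)).hasFDerivAt.hasMFDerivAt
  ext v
  refine (tautologicalForm_apply hz₀
    (mfderiv 𝓘(ℝ, CotModel n) (cotI n) (extChartAt (cotI n) p).symm z (v 0))).trans ?_
  exact congrArg (fun L => (extChartAt (cotI n) p₀ ((extChartAt (cotI n) p).symm z)).2
    (Prod.fst (L (v 0)))) h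

/-- The symplectic form is `dβ ∧ dq` in every natural chart around `p`: the exterior derivative
commutes with the pullback by the change of charts. -/
lemma symplecticForm_apply (hp : p ∈ (extChartAt (cotI n) p₀).source)
    (v w : TangentSpace (cotI n) p) :
    symplecticForm p v w =
      (mvfderiv (cotI n) (extChartAt (cotI n) p₀) p v).2
        (mvfderiv (cotI n) (extChartAt (cotI n) p₀) p w).1 -
      (mvfderiv (cotI n) (extChartAt (cotI n) p₀) p w).2
        (mvfderiv (cotI n) (extChartAt (cotI n) p₀) p v).1 := by
  set z := extChartAt (cotI n) p p with hzdef
  have hz : z ∈ (extChartAt (cotI n) p).target := mem_extChartAt_target p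
  have hpz : (extChartAt (cotI n) p).symm z = p := extChartAt_to_inv p
  have hz₀ : (extChartAt (cotI n) p).symm z ∈ (extChartAt (cotI n) p₀).source := by rwa [hpz]
  have hev : tautologicalFormInChart p =ᶠ[𝓝 z] fun z =>
      (modelTautologicalForm n ((extChartAt (cotI n) p₀ ∘ (extChartAt (cotI n) p).symm) z)
        ).compContinuousLinearMap
        (fderiv ℝ (extChartAt (cotI n) p₀ ∘ (extChartAt (cotI n) p).symm) z) := by
    filter_upwards [(isOpen_extChartAt_target p).mem_nhds hz,
      (continuousAt_extChartAt_symm'' hz) ((isOpen_extChartAt_source p₀).mem_nhds hz₀)]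
      with y hy hy₀ using tautologicalFormInChart_eq_pullback hy hy₀
  have hcomp : ∀ u : TangentSpace (cotI n) p,
      fderiv ℝ (extChartAt (cotI n) p₀ ∘ (extChartAt (cotI n) p).symm) z
        (mvfderiv (cotI n) (extChartAt (cotI n) p) p u) =
      mvfderiv (cotI n) (extChartAt (cotI n) p₀) p u := fun u => by
    have hd := ((contDiffAt_chartChange hz hz₀).differentiableAt (by simp)).hasFDerivAt.hasMFDerivAt
    have h1 := hd.comp p (mdifferentiableAt_extChartAt_cotangent
      (mem_extChartAt_source (I := cotI n) p)).hasMFDerivAt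
    have h2 := (mdifferentiableAt_extChartAt_cotangent hp).hasMFDerivAt
    have hev' : extChartAt (cotI n) p₀ =ᶠ[𝓝 p]
        (extChartAt (cotI n) p₀ ∘ (extChartAt (cotI n) p).symm) ∘ extChartAt (cotI n) p := by
      filter_upwards [extChartAt_source_mem_nhds (I := cotI n) p] with y hy
      simp only [Function.comp_apply, (extChartAt (cotI n) p).left_inv hy]
    exact congrArg (fun L => L u) (hasMFDerivAt_unique (h1.congr_of_eventuallyEq hev') h2)
  rw [symplecticForm, hev.extDeriv_eq, extDeriv_pullback
    (differentiable_modelTautologicalForm _) (contDiffAt_chartChange hz hz₀) (by simp),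
    ContinuousAlternatingMap.compContinuousLinearMap_apply]
  rw [← hcomp v, ← hcomp w, ← extDeriv_modelTautologicalForm
    ((extChartAt (cotI n) p₀ ∘ (extChartAt (cotI n) p).symm) z)]
  congr 1
  ext i : 1
  fin_cases i <;> rfl

end ChartChange

end Cotangent

/-! ### Hamiltonian vectors in natural coordinates -/

section Hamiltonian

variable {n : ℕ} {M : Type*} [TopologicalSpace M] [ChartedSpace (EuclideanSpace ℝ (Fin n)) M]
  [IsManifold (𝓡 n) ∞ M]

local notation "𝓔" => EuclideanSpace ℝ (Fin n)

lemma bijective_mvfderiv_extChartAt_cotangent {p₀ p : CotangentBundle n M}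
    (hp : p ∈ (extChartAt (cotI n) p₀).source) :
    Function.Bijective (mvfderiv (cotI n) (extChartAt (cotI n) p₀) p) :=
  (isInvertible_mfderiv_extChartAt hp).bijective

lemma controlHamiltonian_eq_in_chart
    (X : Metric.sphere (0 : EuclideanSpace ℝ (Fin n)) 1 → (x : M) → TangentSpace (𝓡 n) x)
    (u : Metric.sphere (0 : EuclideanSpace ℝ (Fin n)) 1) {p₀ p : CotangentBundle n M}
    (hp : p ∈ (extChartAt (cotI n) p₀).source) :
    controlHamiltonian X u p = (extChartAt (cotI n) p₀ p).2
      (componentsInChart (chartAt 𝓔 p₀.1) X ((extChartAt (cotI n) p₀ p).1, u)) := by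
  have hp' := mem_extChartAt_cotangent_source.1 hp
  rw [controlHamiltonian, componentsInChart, extChartAt_cotangent_fst]
  simp only
  rw [(chartAt 𝓔 p₀.1).left_inv hp', extChartAt_cotangent_snd_apply _ _ hp']

/-- Hamilton's equations: in natural coordinates `(q, β)`, with `Y` the coordinate expression of
`X_u`, the Hamiltonian vector of `H_u = β Y` is `(Y, - β ∘ DY)`. -/
lemma isHamiltonianVector_iff
    {X : Metric.sphere (0 : EuclideanSpace ℝ (Fin n)) 1 → (x : M) → TangentSpace (𝓡 n) x}
    {u : Metric.sphere (0 : EuclideanSpace ℝ (Fin n)) 1} {p₀ p : CotangentBundle n M}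
    (hp : p ∈ (extChartAt (cotI n) p₀).source) {Y' : 𝓔 →L[ℝ] 𝓔}
    (hY : HasFDerivAt (fun q => componentsInChart (chartAt 𝓔 p₀.1) X (q, u)) Y'
      (extChartAt (cotI n) p₀ p).1) (ξ : TangentSpace (cotI n) p) :
    IsHamiltonianVector (controlHamiltonian X u) p ξ ↔
      mvfderiv (cotI n) (extChartAt (cotI n) p₀) p ξ =
        (componentsInChart (chartAt 𝓔 p₀.1) X ((extChartAt (cotI n) p₀ p).1, u),
          -(extChartAt (cotI n) p₀ p).2.comp Y') := by
  set z := extChartAt (cotI n) p₀ p with hz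
  set Y := fun q => componentsInChart (chartAt 𝓔 p₀.1) X (q, u) with hYdef
  have hH : HasFDerivAt (fun w : CotModel n => w.2 (Y w.1))
      (z.2.comp (Y'.comp (ContinuousLinearMap.fst ℝ 𝓔 (𝓔 →L[ℝ] ℝ))) +
        (ContinuousLinearMap.snd ℝ 𝓔 (𝓔 →L[ℝ] ℝ)).flip (Y z.1)) z :=
    (hasFDerivAt_snd (𝕜 := ℝ) (E := 𝓔) (F := 𝓔 →L[ℝ] ℝ)).clm_apply (hY.comp z hasFDerivAt_fst)
  have hev : controlHamiltonian X u =ᶠ[𝓝 p]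
      (fun w : CotModel n => w.2 (Y w.1)) ∘ extChartAt (cotI n) p₀ := by
    filter_upwards [(isOpen_extChartAt_source p₀).mem_nhds hp] with q hq
      using controlHamiltonian_eq_in_chart X u hq
  have hdH : ∀ v, mvfderiv (cotI n) (controlHamiltonian X u) p v =
      z.2 (Y' (mvfderiv (cotI n) (extChartAt (cotI n) p₀) p v).1) +
        (mvfderiv (cotI n) (extChartAt (cotI n) p₀) p v).2 (Y z.1) := fun v => by
    have h1 := (hH.hasMFDerivAt.comp p
      (mdifferentiableAt_extChartAt_cotangent hp).hasMFDerivAt).congr_of_eventuallyEq hev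
    exact congrArg (fun L => L v) h1.mfderiv
  have hsurj := (bijective_mvfderiv_extChartAt_cotangent hp).2
  simp only [IsHamiltonianVector, hdH, symplecticForm_apply hp]
  generalize mvfderiv (cotI n) (extChartAt (cotI n) p₀) p ξ = ζ
  constructor
  · intro h
    have h' : ∀ w : CotModel n, w.2 ζ.1 - ζ.2 w.1 = z.2 (Y' w.1) + w.2 (Y z.1) := fun w => by
      obtain ⟨v, rfl⟩ := hsurj w
      exact h v
    refine Prod.ext ?_ ?_
    · refine (SeparatingDual.eq_iff_forall_dual_eq (R := ℝ)).2 fun a => ?_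
      simpa using h' (0, a)
    · ext w
      have := h' (w, 0)
      simp only [_root_.zero_apply, zero_sub, add_zero] at this
      simp [← this]
  · intro h v
    simp only [h, _root_.neg_apply, ContinuousLinearMap.comp_apply]
    ring

end Hamiltonian

/-! ### Changes of coordinates and frames -/

section Charts

variable {n : ℕ} {M : Type*} [TopologicalSpace M] [ChartedSpace (EuclideanSpace ℝ (Fin n)) M]

local notation "𝓔" => EuclideanSpace ℝ (Fin n)

lemma mdifferentiableAt_chart
    {χ : OpenPartialHomeomorph M (EuclideanSpace ℝ (Fin n))}
    (hχ : χ ∈ IsManifold.maximalAtlas (𝓡 n) ∞ M) {x : M} (hx : x ∈ χ.source) :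
    MDifferentiableAt (𝓡 n) 𝓘(ℝ, 𝓔) χ x :=
  (contMDiffAt_of_mem_maximalAtlas hχ hx).mdifferentiableAt (by simp)

lemma mdifferentiable_of_mem_maximalAtlas
    {χ : OpenPartialHomeomorph M (EuclideanSpace ℝ (Fin n))}
    (hχ : χ ∈ IsManifold.maximalAtlas (𝓡 n) ∞ M) :
    χ.MDifferentiable (𝓡 n) 𝓘(ℝ, 𝓔) :=
  ⟨(contMDiffOn_of_mem_maximalAtlas hχ).mdifferentiableOn (by simp),
    (contMDiffOn_symm_of_mem_maximalAtlas hχ).mdifferentiableOn (by simp)⟩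

lemma contDiffAt_transition {χ ψ : OpenPartialHomeomorph M (EuclideanSpace ℝ (Fin n))}
    (hχ : χ ∈ IsManifold.maximalAtlas (𝓡 n) ∞ M) (hψ : ψ ∈ IsManifold.maximalAtlas (𝓡 n) ∞ M)
    {q : EuclideanSpace ℝ (Fin n)} (hq : q ∈ χ.target) (hq' : χ.symm q ∈ ψ.source) :
    ContDiffAt ℝ ∞ (ψ ∘ χ.symm) q :=
  contMDiffAt_iff_contDiffAt.1 ((contMDiffAt_of_mem_maximalAtlas hψ hq').comp q
    (contMDiffAt_symm_of_mem_maximalAtlas hχ hq))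

lemma isInvertible_mvfderiv_chart
    {χ : OpenPartialHomeomorph M (EuclideanSpace ℝ (Fin n))}
    (hχ : χ ∈ IsManifold.maximalAtlas (𝓡 n) ∞ M) {x : M} (hx : x ∈ χ.source) :
    (mvfderiv (𝓡 n) χ x).IsInvertible :=
  ⟨(mdifferentiable_of_mem_maximalAtlas hχ).mfderiv hx, rfl⟩

lemma mvfderiv_transition {χ ψ : OpenPartialHomeomorph M (EuclideanSpace ℝ (Fin n))}
    (hχ : χ ∈ IsManifold.maximalAtlas (𝓡 n) ∞ M) (hψ : ψ ∈ IsManifold.maximalAtlas (𝓡 n) ∞ M)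
    {x : M} (hx : x ∈ χ.source) (hx' : x ∈ ψ.source) (v : TangentSpace (𝓡 n) x) :
    mvfderiv (𝓡 n) ψ x v = fderiv ℝ (ψ ∘ χ.symm) (χ x) (mvfderiv (𝓡 n) χ x v) := by
  have hd := ((contDiffAt_transition hχ hψ (χ.map_source hx)
    (by rwa [χ.left_inv hx])).differentiableAt (by simp)).hasFDerivAt.hasMFDerivAt
  have h1 := hd.comp x (mdifferentiableAt_chart hχ hx).hasMFDerivAt
  have h2 := (mdifferentiableAt_chart hψ hx').hasMFDerivAt
  have hev : ψ =ᶠ[𝓝 x] (ψ ∘ χ.symm) ∘ χ := by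
    filter_upwards [χ.open_source.mem_nhds hx] with y hy
    simp only [Function.comp_apply, χ.left_inv hy]
  exact congrArg (fun L => L v) (hasMFDerivAt_unique h2 (h1.congr_of_eventuallyEq hev))

lemma componentsInChart_transition {χ ψ : OpenPartialHomeomorph M (EuclideanSpace ℝ (Fin n))}
    (hχ : χ ∈ IsManifold.maximalAtlas (𝓡 n) ∞ M) (hψ : ψ ∈ IsManifold.maximalAtlas (𝓡 n) ∞ M)
    (X : Metric.sphere (0 : EuclideanSpace ℝ (Fin n)) 1 → (x : M) → TangentSpace (𝓡 n) x)
    (u : Metric.sphere (0 : EuclideanSpace ℝ (Fin n)) 1)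
    {q : EuclideanSpace ℝ (Fin n)} (hq : q ∈ χ.target) (hq' : χ.symm q ∈ ψ.source) :
    componentsInChart χ X (q, u) = fderiv ℝ (χ ∘ ψ.symm) ((ψ ∘ χ.symm) q)
      (componentsInChart ψ X ((ψ ∘ χ.symm) q, u)) := by
  simp only [componentsInChart, Function.comp_apply]
  rw [ψ.left_inv hq']
  exact mvfderiv_transition hψ hχ hq' (χ.map_target hq) _

/-- The vector fields of a control system are differentiable in every system of coordinates. -/
lemma IsControlSystem.differentiableAt_componentsInChart {F : TangentBundle (𝓡 n) M → ℝ}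
    {χ ψ : OpenPartialHomeomorph M (EuclideanSpace ℝ (Fin n))}
    {X : Metric.sphere (0 : EuclideanSpace ℝ (Fin n)) 1 → (x : M) → TangentSpace (𝓡 n) x}
    (hX : IsControlSystem F ψ X) (hχ : χ ∈ IsManifold.maximalAtlas (𝓡 n) ∞ M)
    (u : Metric.sphere (0 : EuclideanSpace ℝ (Fin n)) 1)
    {q : EuclideanSpace ℝ (Fin n)} (hq : q ∈ χ.target) (hq' : χ.symm q ∈ ψ.source) :
    DifferentiableAt ℝ (fun q => componentsInChart χ X (q, u)) q := by
  have hψ := hX.mem_maximalAtlas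
  have htq : (ψ ∘ χ.symm) q ∈ ψ.target := ψ.map_source hq'
  have ht : DifferentiableAt ℝ (ψ ∘ χ.symm) q :=
    (contDiffAt_transition hχ hψ hq hq').differentiableAt (by simp)
  have hback : ContDiffAt ℝ ∞ (χ ∘ ψ.symm) ((ψ ∘ χ.symm) q) :=
    contDiffAt_transition hψ hχ htq
      (by rw [Function.comp_apply, ψ.left_inv hq']; exact χ.map_target hq)
  have h1 : DifferentiableAt ℝ (fun z => fderiv ℝ (χ ∘ ψ.symm) z) ((ψ ∘ χ.symm) q) :=
    (hback.fderiv_right (m := ∞) (by simp)).differentiableAt (by simp)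
  have h2 : DifferentiableAt ℝ (fun z => componentsInChart ψ X (z, u)) ((ψ ∘ χ.symm) q) :=
    (((hX.contDiffOn u).contDiffAt (ψ.open_target.mem_nhds htq))).differentiableAt (by simp)
  refine ((h1.comp q ht).clm_apply (h2.comp q ht)).congr_of_eventuallyEq ?_
  filter_upwards [χ.open_target.mem_nhds hq,
    (χ.continuousAt_symm hq) (ψ.open_source.mem_nhds hq')] with z hz hz'
    using componentsInChart_transition hχ hψ X u hz hz'

variable [IsManifold (𝓡 n) ∞ M]

variable (τ : Trivialization (EuclideanSpace ℝ (Fin n))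
  (π (EuclideanSpace ℝ (Fin n)) (TangentSpace (𝓡 n) : M → Type _)))

/-- The matrix of the frame `τ` in the coordinates `χ`: it takes the `τ`-coordinates of a tangent
vector at `χ⁻¹ q` to its natural coordinates. -/
noncomputable def frameInChart [τ.IsLinear ℝ]
    (χ : OpenPartialHomeomorph M (EuclideanSpace ℝ (Fin n))) (q : EuclideanSpace ℝ (Fin n)) :
    EuclideanSpace ℝ (Fin n) →L[ℝ] EuclideanSpace ℝ (Fin n) :=
  (mvfderiv (𝓡 n) χ (χ.symm q)).comp (τ.symmL ℝ (χ.symm q))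

variable {τ}

lemma isInvertible_frameInChart [τ.IsLinear ℝ]
    {χ : OpenPartialHomeomorph M (EuclideanSpace ℝ (Fin n))}
    (hχ : χ ∈ IsManifold.maximalAtlas (𝓡 n) ∞ M) {q : EuclideanSpace ℝ (Fin n)}
    (hq : q ∈ χ.target) (hq' : χ.symm q ∈ τ.baseSet) : (frameInChart τ χ q).IsInvertible :=
  (isInvertible_mvfderiv_chart hχ (χ.map_target hq)).comp
    ⟨(τ.continuousLinearEquivAt ℝ _ hq').symm,
      ContinuousLinearMap.ext fun v => congrFun (τ.symm_continuousLinearEquivAt_eq hq') v⟩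

lemma mvfderiv_chartAt_eq_trivializationAt {x₀ x : M} (hx : x ∈ (chartAt 𝓔 x₀).source)
    (v : TangentSpace (𝓡 n) x) :
    mvfderiv (𝓡 n) (chartAt 𝓔 x₀) x v =
      (trivializationAt 𝓔 (TangentSpace (𝓡 n)) x₀ ⟨x, v⟩).2 := by
  have h2 : mvfderiv (𝓡 n) (chartAt 𝓔 x₀) x v =
      (trivializationAt 𝓔 (TangentSpace (𝓡 n)) x₀).continuousLinearMapAt ℝ x v := by
    rw [TangentBundle.continuousLinearMapAt_trivializationAt hx]
    rfl
  rw [h2, Trivialization.continuousLinearMapAt_apply, Trivialization.coe_linearMapAt_of_mem]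
  exact hx

lemma contDiffAt_frameInChart_apply {U : Set M} (hτ : IsSmoothLocalTrivialization τ U)
    [τ.IsLinear ℝ] {χ : OpenPartialHomeomorph M (EuclideanSpace ℝ (Fin n))}
    (hχ : χ ∈ IsManifold.maximalAtlas (𝓡 n) ∞ M) {q : EuclideanSpace ℝ (Fin n)}
    (hq : q ∈ χ.target) (hq' : χ.symm q ∈ U) (y : EuclideanSpace ℝ (Fin n)) :
    ContDiffAt ℝ ∞ (fun z => frameInChart τ χ z y) q := by
  set x₀ := χ.symm q with hx₀
  set χ₀ := chartAt 𝓔 x₀ with hχ₀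
  have hχ₀' : χ₀ ∈ IsManifold.maximalAtlas (𝓡 n) ∞ M := IsManifold.chart_mem_maximalAtlas x₀
  have hx₀s : x₀ ∈ χ₀.source := mem_chart_source 𝓔 x₀
  have hs : ContMDiffAt (𝓡 n) (𝓡 n).tangent ∞
      (fun x => τ.toOpenPartialHomeomorph.symm (x, y)) x₀ := by
    have h1 : ContMDiffAt ((𝓡 n).prod (𝓡 n)) (𝓡 n).tangent ∞ τ.toOpenPartialHomeomorph.symm
        (x₀, y) := hτ.contMDiffOn_symm.contMDiffAt (τ.open_target.mem_nhds
          (τ.mem_target.2 (by rw [hτ.baseSet_eq]; exact hq')))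
    exact h1.comp x₀ (contMDiffAt_id.prodMk contMDiffAt_const)
  have hfst : (τ.toOpenPartialHomeomorph.symm (x₀, y)).proj = x₀ :=
    τ.proj_symm_apply (τ.mem_target.2 (by rw [hτ.baseSet_eq]; exact hq'))
  have h2 := (contMDiffAt_totalSpace.1 hs).2
  rw [hfst] at h2
  have h3 : ContDiffAt ℝ ∞ (fun z => fderiv ℝ (χ ∘ χ₀.symm) ((χ₀ ∘ χ.symm) z)
      (trivializationAt 𝓔 (TangentSpace (𝓡 n)) x₀
        (τ.toOpenPartialHomeomorph.symm (χ.symm z, y))).2) q := by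
    have h4 : ContDiffAt ℝ ∞ (fun z => (trivializationAt 𝓔 (TangentSpace (𝓡 n)) x₀
        (τ.toOpenPartialHomeomorph.symm (χ.symm z, y))).2) q :=
      contMDiffAt_iff_contDiffAt.1 (h2.comp q (contMDiffAt_symm_of_mem_maximalAtlas hχ hq))
    have h5 : ContDiffAt ℝ ∞ (fderiv ℝ (χ ∘ χ₀.symm)) ((χ₀ ∘ χ.symm) q) :=
      (contDiffAt_transition hχ₀' hχ (χ₀.map_source hx₀s) (by
        rw [χ₀.left_inv hx₀s]; exact χ.map_target hq)).fderiv_right (by simp)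
    exact (h5.comp q (contDiffAt_transition hχ hχ₀' hq hx₀s)).clm_apply h4
  refine h3.congr_of_eventuallyEq ?_
  have hUopen : IsOpen U := hτ.baseSet_eq ▸ τ.open_baseSet
  filter_upwards [χ.open_target.mem_nhds hq, (χ.continuousAt_symm hq)
    (χ₀.open_source.mem_nhds hx₀s), (χ.continuousAt_symm hq) (hUopen.mem_nhds hq')] with z hz hz' hzU
  have hzb : χ.symm z ∈ τ.baseSet := by rw [hτ.baseSet_eq]; exact hzU
  rw [frameInChart, ContinuousLinearMap.comp_apply,
    mvfderiv_transition hχ₀' hχ hz' (χ.map_target hz), mvfderiv_chartAt_eq_trivializationAt hz']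
  rw [Trivialization.symmL_apply _ hzb, Trivialization.mk_symm _ hzb]
  rfl

lemma contDiffAt_frameInChart {U : Set M} (hτ : IsSmoothLocalTrivialization τ U)
    [τ.IsLinear ℝ] {χ : OpenPartialHomeomorph M (EuclideanSpace ℝ (Fin n))}
    (hχ : χ ∈ IsManifold.maximalAtlas (𝓡 n) ∞ M) {q : EuclideanSpace ℝ (Fin n)}
    (hq : q ∈ χ.target) (hq' : χ.symm q ∈ U) : ContDiffAt ℝ ∞ (frameInChart τ χ) q := by
  have hUopen : IsOpen U := hτ.baseSet_eq ▸ τ.open_baseSet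
  have h : ContDiffOn ℝ ∞ (frameInChart τ χ) (χ.target ∩ χ.symm ⁻¹' U) :=
    contDiffOn_clm_apply.2 fun y z hz =>
      (contDiffAt_frameInChart_apply hτ hχ hz.1 hz.2 y).contDiffWithinAt
  exact h.contDiffAt ((χ.isOpen_inter_preimage_symm hUopen).mem_nhds ⟨hq, hq'⟩)

end Charts

/-! ### Strong convexity in a local trivialization -/

section Trivialization

variable {n : ℕ} {M : Type*} [TopologicalSpace M] [ChartedSpace (EuclideanSpace ℝ (Fin n)) M]
  [IsManifold (𝓡 n) ∞ M]

local notation "𝓔" => EuclideanSpace ℝ (Fin n)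

lemma IsFinslerStructure.pos {G : TangentBundle (𝓡 n) M → ℝ} (hG : IsFinslerStructure G) {x : M}
    {y : TangentSpace (𝓡 n) x} (hy : y ≠ 0) : 0 < G ⟨x, y⟩ := by
  refine lt_of_le_of_ne (hG.nonneg _) fun h0 => ?_
  -- if `G` vanished at `y`, its square would vanish along the ray through `y`
  have h1 := hG.hessian_pos x y y hy hy
  have h2 : (fun t : ℝ => G ⟨x, y + t • y⟩ ^ 2) =ᶠ[𝓝 0] fun _ => 0 := by
    filter_upwards [lt_mem_nhds (show (-1 : ℝ) < 0 by norm_num)] with t ht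
    have h3 : y + t • y = (1 + t) • y := by rw [add_smul, one_smul]
    rw [h3, hG.pos_homogeneous x _ y (by linarith), ← h0]
    simp
  rw [h2.iteratedDeriv_eq] at h1
  simp at h1

variable {τ : Trivialization (EuclideanSpace ℝ (Fin n))
  (π (EuclideanSpace ℝ (Fin n)) (TangentSpace (𝓡 n) : M → Type _))}
  {φ : OpenPartialHomeomorph M (EuclideanSpace ℝ (Fin n))}

lemma inTrivialization_eq [τ.IsLinear ℝ] (F : TangentBundle (𝓡 n) M → ℝ)
    {q : EuclideanSpace ℝ (Fin n)} (hq : φ.symm q ∈ τ.baseSet) (y : EuclideanSpace ℝ (Fin n)) :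
    inTrivialization F τ φ (q, y) = F ⟨φ.symm q, τ.symmL ℝ (φ.symm q) y⟩ := by
  rw [inTrivialization, τ.symmL_apply hq, Trivialization.mk_symm _ hq]

lemma symmL_ne_zero [τ.IsLinear ℝ] {x : M} (hx : x ∈ τ.baseSet) {y : EuclideanSpace ℝ (Fin n)}
    (hy : y ≠ 0) : τ.symmL ℝ x y ≠ 0 := by
  rw [← τ.symm_continuousLinearEquivAt_eq hx]
  exact fun h => hy ((τ.continuousLinearEquivAt ℝ x hx).symm.map_eq_zero_iff.1 h)

lemma continuousOn_inTrivialization_of_isFinslerStructure [τ.IsLinear ℝ]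
    {G : TangentBundle (𝓡 n) M → ℝ} (hG : IsFinslerStructure G) (hφ : φ.source = τ.baseSet) :
    ContinuousOn (inTrivialization G τ φ) (φ.target ×ˢ {0}ᶜ) := by
  have hmem : ∀ q ∈ φ.target, φ.symm q ∈ τ.baseSet := fun q hq => hφ ▸ φ.map_target hq
  have h1 : ContinuousOn (fun q : 𝓔 × 𝓔 => (φ.symm q.1, q.2)) (φ.target ×ˢ {0}ᶜ) :=
    (φ.continuousOn_symm.comp continuousOn_fst fun q hq => hq.1).prodMk continuousOn_snd
  have h2 : ContinuousOn (fun q : 𝓔 × 𝓔 => τ.toOpenPartialHomeomorph.symm (φ.symm q.1, q.2))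
      (φ.target ×ˢ {0}ᶜ) :=
    τ.toOpenPartialHomeomorph.continuousOn_symm.comp h1 fun q hq =>
      τ.mem_target.2 (hmem q.1 hq.1)
  refine hG.contMDiffOn.continuousOn.comp h2 fun q hq => ?_
  rw [mem_ofPred_eq, ← Trivialization.mk_symm _ (hmem q.1 hq.1), ← τ.symmL_apply (R := ℝ)
    (hmem q.1 hq.1)]
  exact symmL_ne_zero (hmem q.1 hq.1) hq.2

/-- A Finsler structure locally dominates a multiple of the Euclidean norm of the coordinates. -/
lemma IsFinslerStructure.exists_le_inTrivialization [τ.IsLinear ℝ]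
    {G : TangentBundle (𝓡 n) M → ℝ} (hG : IsFinslerStructure G) (hφ : φ.source = τ.baseSet)
    {x₀ : EuclideanSpace ℝ (Fin n)} (hx₀ : x₀ ∈ φ.target) :
    ∃ c > 0, ∀ᶠ x in 𝓝 x₀, ∀ y, c * ‖y‖ ≤ inTrivialization G τ φ (x, y) := by
  have hmem : ∀ q ∈ φ.target, φ.symm q ∈ τ.baseSet := fun q hq => hφ ▸ φ.map_target hq
  obtain ⟨r, hr, hball⟩ := Metric.nhds_basis_closedBall.mem_iff.1 (φ.open_target.mem_nhds hx₀)
  have hsub : Metric.closedBall x₀ r ×ˢ Metric.sphere (0 : 𝓔) 1 ⊆ φ.target ×ˢ {0}ᶜ :=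
    prod_mono hball fun y hy h0 => by
      rw [mem_singleton_iff] at h0
      simp [h0] at hy
  obtain ⟨c, hc, hle⟩ := IsCompact.exists_forall_le' (a := 0)
    ((isCompact_closedBall x₀ r).prod (isCompact_sphere (0 : 𝓔) 1))
    ((continuousOn_inTrivialization_of_isFinslerStructure hG hφ).mono hsub) (by
      rintro ⟨x, y⟩ h
      have h' := hsub h
      rw [inTrivialization_eq G (hmem x h'.1)]
      exact hG.pos (symmL_ne_zero (hmem x h'.1) h'.2))
  refine ⟨c, hc, ?_⟩
  filter_upwards [Metric.closedBall_mem_nhds x₀ hr] with x hx y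
  have hxb := hmem x (hball hx)
  rcases eq_or_ne y 0 with rfl | hy
  · rw [inTrivialization_eq G hxb, norm_zero, mul_zero]
    exact hG.nonneg _
  · have hy' : 0 < ‖y‖ := norm_pos_iff.2 hy
    have h1 := hle (x, ‖y‖⁻¹ • y) ⟨hx, by simp [norm_smul, hy'.ne']⟩
    rw [inTrivialization_eq G hxb, map_smul, hG.pos_homogeneous _ _ _ (by positivity),
      ← inTrivialization_eq G hxb, inv_mul_eq_div, le_div_iff₀ hy'] at h1
    exact h1

/-- Strong convexity with respect to a Finsler structure becomes, in a local trivialization,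
strong convexity with a locally uniform modulus. -/
lemma IsStronglyConvexWrt.exists_isStronglyConvexNorm [τ.IsLinear ℝ]
    {F G : TangentBundle (𝓡 n) M → ℝ} (hFG : IsStronglyConvexWrt F G)
    (hG : IsFinslerStructure G) (hφ : φ.source = τ.baseSet)
    (hC1 : IsHorizontallyC1Family (inTrivialization F τ φ) φ.target)
    {x₀ : EuclideanSpace ℝ (Fin n)} (hx₀ : x₀ ∈ φ.target) :
    ∃ c, ∀ᶠ x in 𝓝 x₀, IsStronglyConvexNorm c (fun y => inTrivialization F τ φ (x, y)) := by
  obtain ⟨c, hc, hle⟩ := hG.exists_le_inTrivialization hφ hx₀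
  refine ⟨c ^ 2, ?_⟩
  filter_upwards [hle, φ.open_target.mem_nhds hx₀] with x hx hxD
  have hxb : φ.symm x ∈ τ.baseSet := hφ ▸ φ.map_target hxD
  refine ⟨hC1.isAsymmetricNorm x hxD, ?_, by positivity, fun y z a ha => ?_⟩
  · exact hC1.continuousOn.comp_continuous (by fun_prop) fun y => ⟨hxD, mem_univ _⟩
  · set e := τ.continuousLinearEquivAt ℝ (φ.symm x) hxb
    have he : ∀ y, τ.symmL ℝ (φ.symm x) y = e.symm y := fun y =>
      (congrFun (τ.symm_continuousLinearEquivAt_eq hxb) y).symm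
    have hf : ∀ y, inTrivialization F τ φ (x, y) = F ⟨φ.symm x, e.symm y⟩ := fun y => by
      rw [inTrivialization_eq F hxb, he]
    have hg : ∀ y, inTrivialization G τ φ (x, y) = G ⟨φ.symm x, e.symm y⟩ := fun y => by
      rw [inTrivialization_eq G hxb, he]
    have h1 := hFG (φ.symm x) (e.symm y) (e.symm z) (a.comp e.toContinuousLinearMap) (fun w => by
      have := ha (e w)
      simp only [hf, ContinuousLinearEquiv.symm_apply_apply] at this
      simpa using this)
    have h2 := hx (z - y)
    rw [hg] at h2
    have h3 : c ^ 2 * ‖z - y‖ ^ 2 ≤ G ⟨φ.symm x, e.symm (z - y)⟩ ^ 2 := by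
      rw [← mul_pow]
      exact pow_le_pow_left₀ (by positivity) h2 2
    rw [map_sub] at h3
    simp only [hf]
    have h4 : (a.comp e.toContinuousLinearMap) (e.symm z - e.symm y) = a (z - y) := by simp
    rw [h4] at h1
    linarith

end Trivialization

/-! ### Regularity of the geodesic field in coordinates -/

lemma ContDiffAt.clm_apply_comp {E F G H : Type*} [NormedAddCommGroup E] [NormedSpace ℝ E]
    [NormedAddCommGroup F] [NormedSpace ℝ F] [NormedAddCommGroup G] [NormedSpace ℝ G]
    [NormedAddCommGroup H] [NormedSpace ℝ H] {L : E → F →L[ℝ] G →L[ℝ] H} {y : E → G} {x : E}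
    {k : ℕ∞ω} (hL : ContDiffAt ℝ k L x) (hy : ContDiffAt ℝ k y x) :
    ContDiffAt ℝ k (fun z => (ContinuousLinearMap.apply ℝ H (y z)).comp (L z)) x := by
  have h : ContDiff ℝ k (fun z : G => ContinuousLinearMap.apply ℝ H z) := by fun_prop
  exact (h.contDiffAt.comp x hy).clm_comp hL

section GeodesicField

variable {n : ℕ}

local notation "𝓔" => EuclideanSpace ℝ (Fin n)

/-- The Legendre point of the norm `f (t q, ·)` for the covector with natural coordinates `(q, β)`,
where the matrix `A q` takes the coordinates in which `f` is given to natural coordinates. -/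
noncomputable def legendreCoord (f : EuclideanSpace ℝ (Fin n) × EuclideanSpace ℝ (Fin n) → ℝ)
    (t : EuclideanSpace ℝ (Fin n) → EuclideanSpace ℝ (Fin n))
    (A : EuclideanSpace ℝ (Fin n) → EuclideanSpace ℝ (Fin n) →L[ℝ] EuclideanSpace ℝ (Fin n))
    (z : CotModel n) : EuclideanSpace ℝ (Fin n) :=
  legendrePoint (fun y => f (t z.1, y)) (z.2.comp (A z.1))

/-- The dual norm of the covector with natural coordinates `(q, β)`, as the square root of the
value of the covector at its Legendre point. -/
noncomputable def dualNormCoord (f : EuclideanSpace ℝ (Fin n) × EuclideanSpace ℝ (Fin n) → ℝ)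
    (t : EuclideanSpace ℝ (Fin n) → EuclideanSpace ℝ (Fin n))
    (A : EuclideanSpace ℝ (Fin n) → EuclideanSpace ℝ (Fin n) →L[ℝ] EuclideanSpace ℝ (Fin n))
    (z : CotModel n) : ℝ :=
  √(z.2 (A z.1 (legendreCoord f t A z)))

/-- The point of the unit sphere of `f (t q, ·)` at which the covector with natural coordinates
`(q, β)` is maximal. -/
noncomputable def unitCoord (f : EuclideanSpace ℝ (Fin n) × EuclideanSpace ℝ (Fin n) → ℝ)
    (t : EuclideanSpace ℝ (Fin n) → EuclideanSpace ℝ (Fin n))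
    (A : EuclideanSpace ℝ (Fin n) → EuclideanSpace ℝ (Fin n) →L[ℝ] EuclideanSpace ℝ (Fin n))
    (z : CotModel n) : EuclideanSpace ℝ (Fin n) :=
  (dualNormCoord f t A z)⁻¹ • legendreCoord f t A z

/-- The coordinate expression of the geodesic field at the covector with natural coordinates
`(q, β)`: with `y` the unit vector maximizing the covector and `m` its dual norm, the velocity is
`A y`, and the second component is `m / 2 * d_h f² (t q, y) ∘ Dt - β (DA · y)`. -/
noncomputable def geodesicFieldCoord
    (f : EuclideanSpace ℝ (Fin n) × EuclideanSpace ℝ (Fin n) → ℝ)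
    (t : EuclideanSpace ℝ (Fin n) → EuclideanSpace ℝ (Fin n))
    (A : EuclideanSpace ℝ (Fin n) → EuclideanSpace ℝ (Fin n) →L[ℝ] EuclideanSpace ℝ (Fin n))
    (z : CotModel n) : CotModel n :=
  (A z.1 (unitCoord f t A z),
    (dualNormCoord f t A z / 2) •
      (horizontalDifferential (fun q => f q ^ 2) (t z.1, unitCoord f t A z)).comp
        (fderiv ℝ t z.1) -
    z.2.comp ((ContinuousLinearMap.apply ℝ (EuclideanSpace ℝ (Fin n)) (unitCoord f t A z)).comp
      (fderiv ℝ A z.1)))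

section

variable {f : EuclideanSpace ℝ (Fin n) × EuclideanSpace ℝ (Fin n) → ℝ}
  {t : EuclideanSpace ℝ (Fin n) → EuclideanSpace ℝ (Fin n)}
  {A : EuclideanSpace ℝ (Fin n) → EuclideanSpace ℝ (Fin n) →L[ℝ] EuclideanSpace ℝ (Fin n)}
  {z : CotModel n} {c : ℝ}

lemma isLegendrePoint_legendreCoord (hN : IsStronglyConvexNorm c (fun y => f (t z.1, y))) :
    IsLegendrePoint (fun y => f (t z.1, y)) (z.2.comp (A z.1)) (legendreCoord f t A z) :=
  hN.isLegendrePoint_legendrePoint _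

lemma dualNormCoord_eq (hN : IsStronglyConvexNorm c (fun y => f (t z.1, y))) :
    dualNormCoord f t A z = f (t z.1, legendreCoord f t A z) := by
  have h := hN.apply_eq_sq (isLegendrePoint_legendreCoord (A := A) hN)
  rw [ContinuousLinearMap.comp_apply] at h
  rw [dualNormCoord, h, Real.sqrt_sq (hN.nonneg _)]

lemma unitCoord_eq (hN : IsStronglyConvexNorm c (fun y => f (t z.1, y))) :
    unitCoord f t A z = (f (t z.1, legendreCoord f t A z))⁻¹ • legendreCoord f t A z := by
  rw [unitCoord, dualNormCoord_eq hN]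

/-- The coordinate expression of the geodesic field is locally Lipschitz: it is obtained from the
Legendre point and from the horizontal differential of `f²` by `C¹` operations. -/
lemma lipschitzNear_geodesicFieldCoord {D : Set (EuclideanSpace ℝ (Fin n))} (hD : IsOpen D)
    (hdiff : ∀ y, DifferentiableOn ℝ (fun x => f (x, y) ^ 2) D)
    (hLip : LocallyLipschitzOn (D ×ˢ univ) (horizontalDifferential (fun q => f q ^ 2)))
    (ht : ContDiffAt ℝ ∞ t z.1) (hA : ContDiffAt ℝ ∞ A z.1) (htz : t z.1 ∈ D)
    (hN : ∀ᶠ x in 𝓝 (t z.1), IsStronglyConvexNorm c (fun y => f (x, y)))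
    (hb : z.2.comp (A z.1) ≠ 0) : LipschitzNear (geodesicFieldCoord f t A) z := by
  have hN₀ := hN.self_of_nhds
  have hid := lipschitzNear_id z
  have hst : ContDiffAt ℝ ∞ (fun w : CotModel n => t w.1) z := ht.comp z contDiffAt_fst
  have hsA : ContDiffAt ℝ ∞ (fun w : CotModel n => A w.1) z := hA.comp z contDiffAt_fst
  have hy : LipschitzNear (legendreCoord f t A) z := by
    have h1 : ContDiffAt ℝ 1 (fun w : CotModel n => (t w.1, w.2.comp (A w.1))) z :=
      (hst.prodMk (contDiffAt_snd.clm_comp hsA)).of_le (by simp)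
    exact (lipschitzNear_legendrePoint hD hdiff hLip htz hN (z.2.comp (A z.1))).comp
      (f := fun w : CotModel n => (t w.1, w.2.comp (A w.1))) h1.lipschitzNear
  have hpos : 0 < f (t z.1, legendreCoord f t A z) :=
    hN₀.pos_of_ne_zero (isLegendrePoint_legendreCoord (A := A) hN₀) hb
  have hm : LipschitzNear (dualNormCoord f t A) z := by
    have h1 : ContDiffAt ℝ 1 (fun w : CotModel n × 𝓔 => √(w.1.2 (A w.1.1 w.2)))
        (z, legendreCoord f t A z) := by
      have h2 : ContDiffAt ℝ ∞ (fun w : CotModel n × 𝓔 => A w.1.1) (z, legendreCoord f t A z) :=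
        hA.comp (z, legendreCoord f t A z) (contDiff_fst.comp contDiff_fst).contDiffAt
      have h3 : ContDiffAt ℝ ∞ (fun w : CotModel n × 𝓔 => w.1.2) (z, legendreCoord f t A z) :=
        contDiffAt_snd.comp (z, legendreCoord f t A z) contDiffAt_fst
      refine ((h3.clm_apply (h2.clm_apply contDiffAt_snd)).sqrt ?_).of_le (by simp)
      have h4 := hN₀.apply_eq_sq (isLegendrePoint_legendreCoord (A := A) hN₀)
      rw [ContinuousLinearMap.comp_apply] at h4
      simp only [h4]
      positivity
    exact h1.lipschitzNear.comp (f := fun w => (w, legendreCoord f t A w)) (hid.prodMk hy)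
  have hu : LipschitzNear (unitCoord f t A) z := by
    have h1 : ContDiffAt ℝ 1 (fun w : ℝ × 𝓔 => w.1⁻¹ • w.2)
        (dualNormCoord f t A z, legendreCoord f t A z) :=
      (contDiffAt_fst.inv (by rw [dualNormCoord_eq hN₀]; exact hpos.ne')).smul contDiffAt_snd
    exact h1.lipschitzNear.comp
      (f := fun w => (dualNormCoord f t A w, legendreCoord f t A w)) (hm.prodMk hy)
  have hh : LipschitzNear (fun w : CotModel n =>
      horizontalDifferential (fun q => f q ^ 2) (t w.1, unitCoord f t A w)) z :=
    (hLip.lipschitzNear ((hD.prod isOpen_univ).mem_nhds ⟨htz, mem_univ _⟩)).comp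
      ((hst.of_le (by simp)).lipschitzNear.prodMk hu)
  have hfin : ∀ w₀ : CotModel n × ℝ × 𝓔 × (𝓔 →L[ℝ] ℝ), w₀.1 = z → ContDiffAt ℝ 1
      (fun w : CotModel n × ℝ × 𝓔 × (𝓔 →L[ℝ] ℝ) => ((A w.1.1 w.2.2.1,
        (w.2.1 / 2) • w.2.2.2.comp (fderiv ℝ t w.1.1) -
          w.1.2.comp ((ContinuousLinearMap.apply ℝ 𝓔 w.2.2.1).comp (fderiv ℝ A w.1.1))) :
          CotModel n)) w₀ := by
    rintro w₀ rfl
    have e1 : ContDiffAt ℝ ∞ (fun w : CotModel n × ℝ × 𝓔 × (𝓔 →L[ℝ] ℝ) => w.1.1) w₀ :=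
      (contDiff_fst.comp contDiff_fst).contDiffAt
    have e2 : ContDiffAt ℝ ∞ (fun w : CotModel n × ℝ × 𝓔 × (𝓔 →L[ℝ] ℝ) => w.1.2) w₀ :=
      (contDiff_snd.comp contDiff_fst).contDiffAt
    have e3 : ContDiffAt ℝ ∞ (fun w : CotModel n × ℝ × 𝓔 × (𝓔 →L[ℝ] ℝ) => w.2.1) w₀ :=
      (contDiff_fst.comp contDiff_snd).contDiffAt
    have e4 : ContDiffAt ℝ ∞ (fun w : CotModel n × ℝ × 𝓔 × (𝓔 →L[ℝ] ℝ) => w.2.2.1) w₀ :=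
      (contDiff_fst.comp (contDiff_snd.comp contDiff_snd)).contDiffAt
    have e5 : ContDiffAt ℝ ∞ (fun w : CotModel n × ℝ × 𝓔 × (𝓔 →L[ℝ] ℝ) => w.2.2.2) w₀ :=
      (contDiff_snd.comp (contDiff_snd.comp contDiff_snd)).contDiffAt
    have eA : ContDiffAt ℝ ∞ (fun w : CotModel n × ℝ × 𝓔 × (𝓔 →L[ℝ] ℝ) => A w.1.1) w₀ :=
      hA.comp w₀ e1
    have eT : ContDiffAt ℝ ∞ (fun w : CotModel n × ℝ × 𝓔 × (𝓔 →L[ℝ] ℝ) =>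
        fderiv ℝ t w.1.1) w₀ := (ht.fderiv_right (by simp)).comp w₀ e1
    have eA' : ContDiffAt ℝ ∞ (fun w : CotModel n × ℝ × 𝓔 × (𝓔 →L[ℝ] ℝ) =>
        fderiv ℝ A w.1.1) w₀ := (hA.fderiv_right (by simp)).comp w₀ e1
    exact ((eA.clm_apply e4).prodMk (((e3.div_const 2).smul (e5.clm_comp eT)).sub
      (e2.clm_comp (eA'.clm_apply_comp e4)))).of_le (by simp)
  exact (hfin (z, dualNormCoord f t A z, unitCoord f t A z, _) rfl).lipschitzNear.comp
    (f := fun w => (w, dualNormCoord f t A w, unitCoord f t A w,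
      horizontalDifferential (fun q => f q ^ 2) (t w.1, unitCoord f t A w)))
    (hid.prodMk (hm.prodMk (hu.prodMk hh)))

end

end GeodesicField

/-! ### The extended geodesic field in coordinates -/

section FieldOfControlSystem

variable {n : ℕ} {M : Type*} [TopologicalSpace M] [ChartedSpace (EuclideanSpace ℝ (Fin n)) M]
  [IsManifold (𝓡 n) ∞ M]

local notation "𝓔" => EuclideanSpace ℝ (Fin n)

variable {F : TangentBundle (𝓡 n) M → ℝ}
  {τ : Trivialization (EuclideanSpace ℝ (Fin n))
    (π (EuclideanSpace ℝ (Fin n)) (TangentSpace (𝓡 n) : M → Type _))}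
  {φ : OpenPartialHomeomorph M (EuclideanSpace ℝ (Fin n))} {U : Set M}
  {p₀ p : CotangentBundle n M}

lemma inTrivialization_apply [τ.IsLinear ℝ] (F : TangentBundle (𝓡 n) M → ℝ) {x : M}
    (hx : x ∈ φ.source) (hx' : x ∈ τ.baseSet) (y : EuclideanSpace ℝ (Fin n)) :
    inTrivialization F τ φ (φ x, y) = F ⟨x, τ.symmL ℝ x y⟩ := by
  have h := inTrivialization_eq (φ := φ) (τ := τ) F (q := φ x) (by rwa [φ.left_inv hx]) y
  rwa [φ.left_inv hx] at h

/-- The coordinates of a covector at `x` in the frame `τ`. -/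
lemma extChartAt_cotangent_snd_comp_frameInChart [τ.IsLinear ℝ]
    (hp : p.1 ∈ (chartAt 𝓔 p₀.1).source) (y : EuclideanSpace ℝ (Fin n)) :
    (extChartAt (cotI n) p₀ p).2
      (frameInChart τ (chartAt 𝓔 p₀.1) (extChartAt (cotI n) p₀ p).1 y) =
      p.2 (τ.symmL ℝ p.1 y) := by
  rw [extChartAt_cotangent_fst, frameInChart, ContinuousLinearMap.comp_apply,
    (chartAt 𝓔 p₀.1).left_inv hp, extChartAt_cotangent_snd_apply p₀ p hp]

lemma extChartAt_cotangent_snd_comp_frameInChart_ne_zero [τ.IsLinear ℝ]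
    (hp : p.1 ∈ (chartAt 𝓔 p₀.1).source) (hpτ : p.1 ∈ τ.baseSet) (hp₂ : p.2 ≠ 0) :
    (extChartAt (cotI n) p₀ p).2.comp
      (frameInChart τ (chartAt 𝓔 p₀.1) (extChartAt (cotI n) p₀ p).1) ≠ 0 := by
  intro h
  refine hp₂ (ContinuousLinearMap.ext fun v => ?_)
  have h1 := extChartAt_cotangent_snd_comp_frameInChart (τ := τ) hp
    (τ.continuousLinearMapAt ℝ p.1 v)
  rw [τ.symmL_continuousLinearMapAt hpτ] at h1
  rw [← h1, ← ContinuousLinearMap.comp_apply, h]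
  rfl

/-- The geodesic field of a control system in natural coordinates: the velocity is the unit vector
that maximizes the covector, and the derivative of `H_u` at a maximizing `u` is given by the
envelope principle. -/
theorem mem_extendedGeodesicField_iff [τ.IsLinear ℝ] (hτ : IsSmoothLocalTrivialization τ U)
    (hφ : φ ∈ IsManifold.maximalAtlas (𝓡 n) ∞ M) (hφU : φ.source = U)
    (hdiff : ∀ y, DifferentiableOn ℝ (fun x => inTrivialization F τ φ (x, y) ^ 2) φ.target)
    (hcont : ContinuousOn (horizontalDifferential (fun q => inTrivialization F τ φ q ^ 2))
      (φ.target ×ˢ univ))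
    {ψ : OpenPartialHomeomorph M (EuclideanSpace ℝ (Fin n))}
    {X : Metric.sphere (0 : EuclideanSpace ℝ (Fin n)) 1 → (x : M) → TangentSpace (𝓡 n) x}
    (hX : IsControlSystem F ψ X) (hpU : p ∈ slitCotangentOver U) (hpψ : p.1 ∈ ψ.source)
    (hp : p ∈ (extChartAt (cotI n) p₀).source) {c : ℝ}
    (hN : IsStronglyConvexNorm c (fun y => inTrivialization F τ φ (φ p.1, y)))
    (ξ : TangentSpace (cotI n) p) :
    ξ ∈ extendedGeodesicField X p ↔
      mvfderiv (cotI n) (extChartAt (cotI n) p₀) p ξ =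
        geodesicFieldCoord (inTrivialization F τ φ) (φ ∘ (chartAt 𝓔 p₀.1).symm)
          (frameInChart τ (chartAt 𝓔 p₀.1)) (extChartAt (cotI n) p₀ p) := by
  set χ := chartAt 𝓔 p₀.1 with hχdef
  have hχ : χ ∈ IsManifold.maximalAtlas (𝓡 n) ∞ M := IsManifold.chart_mem_maximalAtlas p₀.1
  have hpχ : p.1 ∈ χ.source := mem_extChartAt_cotangent_source.1 hp
  have hpτ : p.1 ∈ τ.baseSet := by rw [hτ.baseSet_eq]; exact hpU.1
  have hpφ : p.1 ∈ φ.source := by rw [hφU]; exact hpU.1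
  set f := inTrivialization F τ φ with hf
  set t := φ ∘ χ.symm with ht
  set A := frameInChart τ χ with hA
  set z := extChartAt (cotI n) p₀ p with hz
  have hz1 : z.1 = χ p.1 := extChartAt_cotangent_fst p₀ p
  have hqχ : z.1 ∈ χ.target := by rw [hz1]; exact χ.map_source hpχ
  have hqp : χ.symm z.1 = p.1 := by rw [hz1, χ.left_inv hpχ]
  have htq : t z.1 = φ p.1 := by rw [ht, Function.comp_apply, hqp]
  have htD : t z.1 ∈ φ.target := by rw [htq]; exact φ.map_source hpφ
  rw [← htq] at hN
  set b := z.2.comp (A z.1) with hb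
  have hbv : ∀ y, b y = p.2 (τ.symmL ℝ p.1 y) := fun y =>
    extChartAt_cotangent_snd_comp_frameInChart hpχ y
  have hb0 : b ≠ 0 := extChartAt_cotangent_snd_comp_frameInChart_ne_zero hpχ hpτ hpU.2
  have hleg := isLegendrePoint_legendreCoord (A := A) hN
  set e := τ.continuousLinearEquivAt ℝ p.1 hpτ with he
  have hes : ∀ y, τ.symmL ℝ p.1 y = e.symm y := fun y =>
    (congrFun (τ.symm_continuousLinearEquivAt_eq hpτ) y).symm
  have hfF : ∀ y, f (t z.1, y) = F ⟨p.1, e.symm y⟩ := fun y => by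
    rw [htq, ← hes]; exact inTrivialization_apply F hpφ hpτ y
  have hXF : ∀ u, F ⟨p.1, X u p.1⟩ = 1 := fun u =>
    ((hX.range_eq p.1 hpψ).subset (mem_range_self u) :)
  have hXe : ∀ u, f (t z.1, e (X u p.1)) = 1 := fun u => by
    rw [hfF, e.symm_apply_apply, hXF]
  have hham : ∀ u, controlHamiltonian X u p = b (e (X u p.1)) := fun u => by
    rw [hbv, hes, e.symm_apply_apply]; rfl
  have hsurj : ∀ y, f (t z.1, y) = 1 → ∃ u, e (X u p.1) = y := fun y hy => by
    rw [hfF] at hy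
    obtain ⟨u, hu⟩ := (hX.range_eq p.1 hpψ).symm.subset hy
    exact ⟨u, by simp only at hu; rw [hu, e.apply_symm_apply]⟩
  have hmpos : 0 < dualNormCoord f t A z := by
    rw [dualNormCoord_eq hN]; exact hN.pos_of_ne_zero hleg hb0
  have hdual : ∀ v, b v ≤ dualNormCoord f t A z * f (t z.1, v) := by
    rw [dualNormCoord_eq hN]; exact hN.apply_le hleg hb0
  have hbu : b (unitCoord f t A z) = dualNormCoord f t A z := by
    rw [unitCoord_eq hN, dualNormCoord_eq hN]; exact hN.apply_inv_smul hleg hb0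
  have hfu : f (t z.1, unitCoord f t A z) = 1 := by
    rw [unitCoord_eq hN]; exact hN.norm_inv_smul hleg hb0
  -- `u` maximizes the Hamiltonian exactly when `X_u` is the normalized Legendre point
  have hmaxiff : ∀ u, (∀ v, controlHamiltonian X v p ≤ controlHamiltonian X u p) ↔
      e (X u p.1) = unitCoord f t A z := fun u => by
    constructor
    · intro h
      rw [unitCoord_eq hN]
      refine hN.eq_inv_smul_of_isMax hleg hb0 (hXe u) fun w hw => ?_
      obtain ⟨v, rfl⟩ := hsurj w hw
      simpa only [hham] using h v
    · intro h v
      rw [hham, hham, h, hbu]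
      simpa only [hXe, mul_one] using hdual (e (X v p.1))
  -- the Hamiltonian vector for a maximizing `u`
  have hmain : ∀ u, e (X u p.1) = unitCoord f t A z →
      (IsHamiltonianVector (controlHamiltonian X u) p ξ ↔
        mvfderiv (cotI n) (extChartAt (cotI n) p₀) p ξ = geodesicFieldCoord f t A z) := by
    intro u hu
    have hYd : DifferentiableAt ℝ (fun q => componentsInChart χ X (q, u)) z.1 :=
      hX.differentiableAt_componentsInChart hχ u hqχ (by rwa [hqp])
    have hAd : ContDiffAt ℝ ∞ A z.1 := contDiffAt_frameInChart hτ hχ hqχ (by rw [hqp]; exact hpU.1)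
    have hAi : (A z.1).IsInvertible := isInvertible_frameInChart hχ hqχ (by rwa [hqp])
    have htd : DifferentiableAt ℝ t z.1 :=
      (contDiffAt_transition hχ hφ hqχ (by rwa [hqp])).differentiableAt (by simp)
    -- the coordinates of `X_u` in the frame `τ`
    set y : 𝓔 → 𝓔 := fun q => (A q).inverse (componentsInChart χ X (q, u)) with hydef
    have hinv : DifferentiableAt ℝ (fun q => (A q).inverse) z.1 := by
      obtain ⟨L, hL⟩ := hAi
      have h1 : ContDiffAt ℝ ∞ ContinuousLinearMap.inverse (A z.1) :=
        hL ▸ contDiffAt_map_inverse L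
      exact ((h1.comp z.1 hAd).differentiableAt (by simp))
    have hyd : DifferentiableAt ℝ y z.1 := hinv.clm_apply hYd
    have hnear : ∀ᶠ q in 𝓝 z.1, q ∈ χ.target ∧ χ.symm q ∈ U ∧ χ.symm q ∈ ψ.source := by
      have hUopen : IsOpen U := hτ.baseSet_eq ▸ τ.open_baseSet
      have hc := χ.continuousAt_symm hqχ
      filter_upwards [χ.open_target.mem_nhds hqχ,
        hc (hUopen.mem_nhds (by rw [hqp]; exact hpU.1)),
        hc (ψ.open_source.mem_nhds (by rwa [hqp]))] with q h1 h2 h3 using ⟨h1, h2, h3⟩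
    have hyX : ∀ q, q ∈ χ.target ∧ χ.symm q ∈ U ∧ χ.symm q ∈ ψ.source →
        τ.symmL ℝ (χ.symm q) (y q) = X u (χ.symm q) := fun q hq => by
      have hqτ : χ.symm q ∈ τ.baseSet := by rw [hτ.baseSet_eq]; exact hq.2.1
      have h1 := isInvertible_mvfderiv_chart hχ (χ.map_target hq.1)
      refine h1.injective ?_
      have h2 := (isInvertible_frameInChart hχ hq.1 hqτ).self_apply_inverse
        (componentsInChart χ X (q, u))
      exact h2
    have hAy : (fun q => componentsInChart χ X (q, u)) =ᶠ[𝓝 z.1] fun q => A q (y q) := by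
      filter_upwards [hnear] with q hq
      rw [hA, frameInChart, ContinuousLinearMap.comp_apply, hyX q hq]
      rfl
    have hfy : ∀ᶠ q in 𝓝 z.1, f (t q, y q) = 1 := by
      filter_upwards [hnear] with q hq
      have hqτ : χ.symm q ∈ τ.baseSet := by rw [hτ.baseSet_eq]; exact hq.2.1
      rw [ht, Function.comp_apply, hf, inTrivialization_apply F (by rw [hφU]; exact hq.2.1) hqτ,
        hyX q hq]
      exact (hX.range_eq _ hq.2.2).subset (mem_range_self u)
    have hy0 : y z.1 = unitCoord f t A z := by
      have h1 := hyX z.1 hnear.self_of_nhds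
      rw [hqp, hes] at h1
      rw [← hu, ← h1, e.apply_symm_apply]
    have henv := envelope φ.open_target hdiff hcont htd.hasFDerivAt htD hyd.hasFDerivAt hfy
      hmpos hdual (by rw [hy0, hbu])
    have hY' : HasFDerivAt (fun q => componentsInChart χ X (q, u))
        ((A z.1).comp (fderiv ℝ y z.1) + (fderiv ℝ A z.1).flip (y z.1)) z.1 :=
      ((hAd.differentiableAt (by simp)).hasFDerivAt.clm_apply
        hyd.hasFDerivAt).congr_of_eventuallyEq hAy
    rw [isHamiltonianVector_iff hp hY', geodesicFieldCoord]
    refine Eq.congr_right (Prod.ext ?_ ?_)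
    · have := hAy.self_of_nhds
      simp only at this
      rw [this, hy0]
    · ext w
      have h1 := congrArg (fun L => L w) henv
      simp only [ContinuousLinearMap.comp_apply, _root_.smul_apply, smul_eq_mul, hb] at h1
      rw [hy0] at h1
      simp only [_root_.neg_apply, ContinuousLinearMap.comp_apply, _root_.add_apply, map_add,
        _root_.sub_apply, _root_.smul_apply, smul_eq_mul, ContinuousLinearMap.flip_apply, hy0,
        ContinuousLinearMap.apply_apply]
      rw [← hz, h1]
      ring
  constructor
  · rintro ⟨u, hu, hξ⟩
    exact (hmain u ((hmaxiff u).1 hu)).1 hξ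
  · intro h
    obtain ⟨u, hu⟩ := hsurj _ hfu
    exact ⟨u, (hmaxiff u).2 hu, (hmain u hu).2 h⟩

end FieldOfControlSystem

/-! ### Existence of a control system -/

section Pontryagin

variable {n : ℕ} {M : Type*} [TopologicalSpace M] [ChartedSpace (EuclideanSpace ℝ (Fin n)) M]
  [IsManifold (𝓡 n) ∞ M]

local notation "𝓔" => EuclideanSpace ℝ (Fin n)

/-- The radial control system of the trivialization `τ`: the vector fields `y / F(y)`, where `y`
has constant coordinates `u ∈ Sⁿ⁻¹` in the frame `τ`. -/
noncomputable def radialControl (F : TangentBundle (𝓡 n) M → ℝ)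
    (τ : Trivialization (EuclideanSpace ℝ (Fin n))
      (π (EuclideanSpace ℝ (Fin n)) (TangentSpace (𝓡 n) : M → Type _))) [τ.IsLinear ℝ]
    (φ : OpenPartialHomeomorph M (EuclideanSpace ℝ (Fin n)))
    (u : Metric.sphere (0 : EuclideanSpace ℝ (Fin n)) 1) (x : M) : TangentSpace (𝓡 n) x :=
  τ.symmL ℝ x ((inTrivialization F τ φ (φ x, u))⁻¹ • (u : EuclideanSpace ℝ (Fin n)))

variable {F : TangentBundle (𝓡 n) M → ℝ}
  {τ : Trivialization (EuclideanSpace ℝ (Fin n))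
    (π (EuclideanSpace ℝ (Fin n)) (TangentSpace (𝓡 n) : M → Type _))}
  {φ : OpenPartialHomeomorph M (EuclideanSpace ℝ (Fin n))} {U : Set M}

lemma componentsInChart_radialControl [τ.IsLinear ℝ] {z : EuclideanSpace ℝ (Fin n)}
    (hz : z ∈ φ.target) (u : Metric.sphere (0 : EuclideanSpace ℝ (Fin n)) 1) :
    componentsInChart φ (radialControl F τ φ) (z, u) =
      frameInChart τ φ z ((inTrivialization F τ φ (z, u))⁻¹ • (u : 𝓔)) := by
  simp only [componentsInChart, radialControl, frameInChart, ContinuousLinearMap.comp_apply]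
  rw [φ.right_inv hz]

lemma IsAsymmetricNorm.pos {V : Type*} [AddCommGroup V] [Module ℝ V] {N : V → ℝ}
    (hN : IsAsymmetricNorm N) {y : V} (hy : y ≠ 0) : 0 < N y :=
  lt_of_le_of_ne (hN.nonneg y) fun h => hy ((hN.eq_zero_iff y).1 h.symm)

lemma IsAsymmetricNorm.pos_of_mem_sphere {N : EuclideanSpace ℝ (Fin n) → ℝ}
    (hN : IsAsymmetricNorm N) (u : Metric.sphere (0 : EuclideanSpace ℝ (Fin n)) 1) :
    0 < N u :=
  hN.pos (ne_zero_of_mem_unit_sphere u)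

/-- Radial projection embeds the Euclidean unit sphere. -/
lemma isEmbedding_inv_smul_sphere {N : EuclideanSpace ℝ (Fin n) → ℝ} (hN : IsAsymmetricNorm N)
    (hc : Continuous N) : IsEmbedding
      (fun u : Metric.sphere (0 : EuclideanSpace ℝ (Fin n)) 1 => (N u)⁻¹ • (u : 𝓔)) := by
  have hcont : Continuous
      (fun u : Metric.sphere (0 : EuclideanSpace ℝ (Fin n)) 1 => (N u)⁻¹ • (u : 𝓔)) :=
    ((hc.comp continuous_subtype_val).inv₀ fun u => (hN.pos_of_mem_sphere u).ne').smul
      continuous_subtype_val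
  refine (hcont.isClosedEmbedding fun u v huv => ?_).isEmbedding
  have hu := hN.pos_of_mem_sphere u
  have hv := hN.pos_of_mem_sphere v
  have h1 := congrArg norm huv
  simp only [norm_smul, norm_inv, Real.norm_eq_abs, abs_of_pos hu, abs_of_pos hv,
    norm_eq_of_mem_sphere, mul_one] at h1
  have h2 := inv_injective h1
  simp only [h2] at huv
  exact Subtype.ext (smul_right_injective 𝓔 (inv_ne_zero hv.ne') huv)

lemma range_inv_smul_sphere {N : EuclideanSpace ℝ (Fin n) → ℝ} (hN : IsAsymmetricNorm N) :
    range (fun u : Metric.sphere (0 : EuclideanSpace ℝ (Fin n)) 1 => (N u)⁻¹ • (u : 𝓔)) =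
      {y | N y = 1} := by
  ext y
  constructor
  · rintro ⟨u, rfl⟩
    have hu := hN.pos_of_mem_sphere u
    rw [mem_ofPred_eq, hN.pos_homogeneous _ _ (inv_pos.2 hu), inv_mul_cancel₀ hu.ne']
  · intro hy
    rw [mem_ofPred_eq] at hy
    have hy0 : y ≠ 0 := fun h => by
      rw [(hN.eq_zero_iff y).2 h] at hy
      exact zero_ne_one hy
    have hpos : 0 < ‖y‖ := norm_pos_iff.2 hy0
    refine ⟨⟨‖y‖⁻¹ • y, by simp [norm_smul, hpos.ne']⟩, ?_⟩
    simp only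
    rw [hN.pos_homogeneous _ _ (inv_pos.2 hpos), hy, mul_one, inv_inv, smul_smul,
      mul_inv_cancel₀ hpos.ne', one_smul]

/-- Each vector field of the radial control system, in the coordinates `φ`, is the frame applied to
`u / f (z, u)`; this is its derivative. -/
lemma hasFDerivAt_frameInChart_inv_smul
    {f : EuclideanSpace ℝ (Fin n) × EuclideanSpace ℝ (Fin n) → ℝ}
    {D : Set (EuclideanSpace ℝ (Fin n))} (hC1 : IsHorizontallyC1Family f D)
    {A : EuclideanSpace ℝ (Fin n) → EuclideanSpace ℝ (Fin n) →L[ℝ] EuclideanSpace ℝ (Fin n)}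
    {z : EuclideanSpace ℝ (Fin n)} (hz : z ∈ D) (hA : DifferentiableAt ℝ A z)
    (u : Metric.sphere (0 : EuclideanSpace ℝ (Fin n)) 1) :
    HasFDerivAt (fun z => A z ((f (z, u))⁻¹ • (u : 𝓔)))
      ((f (z, u))⁻¹ • (ContinuousLinearMap.apply ℝ 𝓔 (u : 𝓔)).comp (fderiv ℝ A z) +
        (-(f (z, u) ^ 2)⁻¹) •
          (ContinuousLinearMap.toSpanSingleton ℝ (A z u)).comp (horizontalDifferential f (z, u)))
      z := by
  have hpos := (hC1.isAsymmetricNorm z hz).pos_of_mem_sphere u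
  have hf := (hasDerivAt_inv hpos.ne').comp_hasFDerivAt z
    (hasFDerivAt_horizontal hC1.isOpen hC1.differentiableOn hz u)
  have h := hf.smul ((ContinuousLinearMap.apply ℝ 𝓔 (u : 𝓔)).hasFDerivAt.comp z hA.hasFDerivAt)
  refine (h.congr_of_eventuallyEq (.of_forall fun x => ?_)).congr_fderiv ?_
  · simp
  · ext w : 1
    simp [smul_smul]

/-- The partial derivatives are continuous jointly in the point and `u` because both `f` and its
horizontal differential are continuous, and `f` is positive on `D × Sⁿ⁻¹`. -/
theorem isControlSystem_radialControl [τ.IsLinear ℝ] (hτ : IsSmoothLocalTrivialization τ U)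
    (hφ : φ ∈ IsManifold.maximalAtlas (𝓡 n) ∞ M) (hφU : φ.source = U)
    (hC1 : IsHorizontallyC1Family (inTrivialization F τ φ) φ.target) :
    IsControlSystem F φ (radialControl F τ φ) := by
  set f := inTrivialization F τ φ with hf
  set A := frameInChart τ φ with hA
  have hAs : ∀ z ∈ φ.target, ContDiffAt ℝ ∞ A z := fun z hz =>
    contDiffAt_frameInChart hτ hφ hz (hφU ▸ φ.map_target hz)
  have hAd : ∀ z ∈ φ.target, DifferentiableAt ℝ A z := fun z hz =>
    (hAs z hz).differentiableAt (by simp)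
  have hpos : ∀ z ∈ φ.target, ∀ u : Metric.sphere (0 : 𝓔) 1, 0 < f (z, u) := fun z hz u =>
    (hC1.isAsymmetricNorm z hz).pos_of_mem_sphere u
  have hcomp : ∀ u, EqOn (fun z => componentsInChart φ (radialControl F τ φ) (z, u))
      (fun z => A z ((f (z, u))⁻¹ • (u : 𝓔))) φ.target := fun u z hz =>
    componentsInChart_radialControl hz u
  have hder : ∀ u, ∀ z ∈ φ.target,
      HasFDerivAt (fun z => componentsInChart φ (radialControl F τ φ) (z, u))
      ((f (z, u))⁻¹ • (ContinuousLinearMap.apply ℝ 𝓔 (u : 𝓔)).comp (fderiv ℝ A z) +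
        (-(f (z, u) ^ 2)⁻¹) •
          (ContinuousLinearMap.toSpanSingleton ℝ (A z u)).comp (horizontalDifferential f (z, u)))
      z := fun u z hz =>
    (hasFDerivAt_frameInChart_inv_smul hC1 hz (hAd z hz) u).congr_of_eventuallyEq
      ((hcomp u).eventuallyEq_of_mem (φ.open_target.mem_nhds hz))
  -- continuity of the ingredients on `D × Sⁿ⁻¹`
  have cu : ContinuousOn (fun q : 𝓔 × Metric.sphere (0 : 𝓔) 1 => ((q.1, (q.2 : 𝓔)) : 𝓔 × 𝓔))
      (φ.target ×ˢ univ) := by fun_prop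
  have cm : MapsTo (fun q : 𝓔 × Metric.sphere (0 : 𝓔) 1 => ((q.1, (q.2 : 𝓔)) : 𝓔 × 𝓔))
      (φ.target ×ˢ univ) (φ.target ×ˢ univ) := fun q hq => ⟨hq.1, mem_univ _⟩
  have cf := hC1.continuousOn.comp cu cm
  have cd := hC1.continuousOn_differential.comp cu cm
  have cA : ContinuousOn (fun q : 𝓔 × Metric.sphere (0 : 𝓔) 1 => A q.1) (φ.target ×ˢ univ) :=
    ContinuousOn.comp (t := φ.target) (fun z hz => (hAs z hz).continuousAt.continuousWithinAt)
      continuousOn_fst fun q hq => hq.1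
  have cA' : ContinuousOn (fun q : 𝓔 × Metric.sphere (0 : 𝓔) 1 => fderiv ℝ A q.1)
      (φ.target ×ˢ univ) :=
    ContinuousOn.comp (t := φ.target) (g := fderiv ℝ A) (fun z hz =>
      ((hAs z hz).fderiv_right (m := 0) (by simp)).continuousAt.continuousWithinAt)
      continuousOn_fst fun q hq => hq.1
  have cU : ContinuousOn (fun q : 𝓔 × Metric.sphere (0 : 𝓔) 1 => (q.2 : 𝓔)) (φ.target ×ˢ univ) :=
    by fun_prop
  have hcd : ContinuousOn (fun q : 𝓔 × Metric.sphere (0 : 𝓔) 1 =>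
      fderiv ℝ (fun z => componentsInChart φ (radialControl F τ φ) (z, q.2)) q.1)
      (φ.target ×ˢ univ) := by
    have c1 := (cf.inv₀ fun q hq => (hpos q.1 hq.1 q.2).ne').smul
      (((ContinuousLinearMap.apply ℝ 𝓔 (E := 𝓔)).continuous.comp_continuousOn cU).clm_comp cA')
    have c2 := ((cf.pow 2).inv₀ fun q hq => (pow_pos (hpos q.1 hq.1 q.2) 2).ne').neg.smul
      (((ContinuousLinearMap.toSpanSingletonCLE (𝕜 := ℝ) (E := 𝓔)).continuous.comp_continuousOn
        (cA.clm_apply cU)).clm_comp cd)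
    exact (c1.add c2).congr fun q hq => (hder q.2 q.1 hq.1).fderiv
  refine ⟨hφ, fun u => ?_, fun x hx => ?_, fun x hx => ?_, ?_, hcd⟩
  · rw [show (1 : ℕ∞ω) = 0 + 1 from rfl, contDiffOn_succ_iff_fderiv_of_isOpen φ.open_target]
    refine ⟨fun z hz => (hder u z hz).differentiableAt.differentiableWithinAt, by simp,
      contDiffOn_zero.2 ?_⟩
    exact hcd.comp (f := fun z => (z, u)) (by fun_prop) fun z hz => ⟨hz, mem_univ _⟩
  · have hxτ : x ∈ τ.baseSet := by rw [hτ.baseSet_eq, ← hφU]; exact hx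
    have hN := hC1.isAsymmetricNorm (φ x) (φ.map_source hx)
    have hc : Continuous (fun y => f (φ x, y)) :=
      hC1.continuousOn.comp_continuous (by fun_prop) fun y => ⟨φ.map_source hx, mem_univ _⟩
    have h := (τ.continuousLinearEquivAt ℝ x hxτ).symm.toHomeomorph.isEmbedding.comp
      (isEmbedding_inv_smul_sphere hN hc)
    convert h using 1
    funext u
    exact (congrFun (τ.symm_continuousLinearEquivAt_eq hxτ) _).symm
  · have hxτ : x ∈ τ.baseSet := by rw [hτ.baseSet_eq, ← hφU]; exact hx
    have hN := hC1.isAsymmetricNorm (φ x) (φ.map_source hx)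
    have hr := range_inv_smul_sphere hN
    ext v
    constructor
    · rintro ⟨u, rfl⟩
      have h1 := hr.subset (mem_range_self u)
      rw [mem_ofPred_eq] at h1 ⊢
      simp only [radialControl]
      rw [← inTrivialization_apply F hx hxτ]
      exact h1
    · intro hv
      rw [mem_ofPred_eq] at hv
      have h1 := inTrivialization_apply F hx hxτ (τ.continuousLinearMapAt ℝ x v)
      rw [τ.symmL_continuousLinearMapAt hxτ, hv] at h1
      obtain ⟨u, hu⟩ := hr.symm.subset h1
      refine ⟨u, ?_⟩
      simp only at hu
      simp only [radialControl]
      rw [hu, τ.symmL_continuousLinearMapAt hxτ]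
  · exact (cA.clm_apply ((cf.inv₀ fun q hq => (hpos q.1 hq.1 q.2).ne').smul cU)).congr
      fun q hq => hcomp q.2 hq.1

end Pontryagin

/-! ### The geodesic field of a Finsler structure -/

section Main

variable {n : ℕ} {M : Type*} [TopologicalSpace M] [ChartedSpace (EuclideanSpace ℝ (Fin n)) M]
  [IsManifold (𝓡 n) ∞ M]

local notation "𝓔" => EuclideanSpace ℝ (Fin n)

lemma extChartAt_cotangent_snd_ne_zero_iff {p₀ p : CotangentBundle n M}
    (hp : p ∈ (extChartAt (cotI n) p₀).source) :
    (extChartAt (cotI n) p₀ p).2 ≠ 0 ↔ p.2 ≠ 0 := by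
  have hp' := mem_extChartAt_cotangent_source.1 hp
  have h := extChartAt_cotangent_snd_apply p₀ p hp'
  refine not_congr ⟨fun h0 => ContinuousLinearMap.ext fun v => ?_, fun h0 => ?_⟩
  · rw [← h v, h0]; rfl
  · ext1 w
    obtain ⟨v, rfl⟩ := (isInvertible_mvfderiv_chart
      (IsManifold.chart_mem_maximalAtlas (n := ∞) (I := 𝓡 n) p₀.1) hp').surjective w
    rw [h v, h0]; rfl

/-- The coordinate expression of the geodesic field in the natural chart of `T*M` at `p₀`. -/
noncomputable def geodesicFieldInChart (F : TangentBundle (𝓡 n) M → ℝ)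
    (τ : Trivialization (EuclideanSpace ℝ (Fin n))
      (π (EuclideanSpace ℝ (Fin n)) (TangentSpace (𝓡 n) : M → Type _))) [τ.IsLinear ℝ]
    (φ : OpenPartialHomeomorph M (EuclideanSpace ℝ (Fin n))) (p₀ : CotangentBundle n M) :
    CotModel n → CotModel n :=
  geodesicFieldCoord (inTrivialization F τ φ) (φ ∘ (chartAt 𝓔 p₀.1).symm)
    (frameInChart τ (chartAt 𝓔 p₀.1))

/-- The geodesic field: the tangent vector at `p` whose expression in the chart at `p` is the
coordinate expression of the geodesic field. -/
noncomputable def geodesicField (F : TangentBundle (𝓡 n) M → ℝ)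
    (τ : Trivialization (EuclideanSpace ℝ (Fin n))
      (π (EuclideanSpace ℝ (Fin n)) (TangentSpace (𝓡 n) : M → Type _))) [τ.IsLinear ℝ]
    (φ : OpenPartialHomeomorph M (EuclideanSpace ℝ (Fin n))) (p : CotangentBundle n M) :
    TangentSpace (cotI n) p :=
  Classical.choose ((bijective_mvfderiv_extChartAt_cotangent
    (mem_extChartAt_source (I := cotI n) p)).2
      (geodesicFieldInChart F τ φ p (extChartAt (cotI n) p p)))

variable {F G : TangentBundle (𝓡 n) M → ℝ} {U : Set M}
  {τ : Trivialization (EuclideanSpace ℝ (Fin n))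
    (π (EuclideanSpace ℝ (Fin n)) (TangentSpace (𝓡 n) : M → Type _))}
  {φ : OpenPartialHomeomorph M (EuclideanSpace ℝ (Fin n))}

lemma mvfderiv_geodesicField_self [τ.IsLinear ℝ] (p : CotangentBundle n M) :
    mvfderiv (cotI n) (extChartAt (cotI n) p) p (geodesicField F τ φ p) =
      geodesicFieldInChart F τ φ p (extChartAt (cotI n) p p) :=
  Classical.choose_spec ((bijective_mvfderiv_extChartAt_cotangent
    (mem_extChartAt_source (I := cotI n) p)).2
      (geodesicFieldInChart F τ φ p (extChartAt (cotI n) p p)))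

end Main

theorem mainTheorem4 {n : ℕ} {M : Type*} [TopologicalSpace M]
    [ChartedSpace (EuclideanSpace ℝ (Fin n)) M] [IsManifold (𝓡 n) ∞ M]
    (F G : TangentBundle (𝓡 n) M → ℝ)
    (hF : IsC0FinslerStructure F) (hG : IsFinslerStructure G) (hFG : IsStronglyConvexWrt F G)
    (U : Set M)
    (τ : Trivialization (EuclideanSpace ℝ (Fin n))
      (π (EuclideanSpace ℝ (Fin n)) (TangentSpace (𝓡 n) : M → Type _)))
    (hτ : IsSmoothLocalTrivialization τ U)
    (φ : OpenPartialHomeomorph M (EuclideanSpace ℝ (Fin n)))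
    (hφ : φ ∈ IsManifold.maximalAtlas (𝓡 n) ∞ M) (hφU : φ.source = U)
    (hC2 : IsHorizontallyC2Family (inTrivialization F τ φ) φ.target)
    (hLip : LocallyLipschitzOn (φ.target ×ˢ univ)
      (horizontalDifferential (fun q => inTrivialization F τ φ q ^ 2))) :
    (∀ x ∈ U, IsPontryaginTypeAt F x) ∧
    ∃ ξ : (p : CotangentBundle n M) → TangentSpace (cotI n) p,
      IsLocallyLipschitzVectorFieldOn ξ (slitCotangentOver U) ∧
      ∀ (ψ : OpenPartialHomeomorph M (EuclideanSpace ℝ (Fin n)))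
        (X : Metric.sphere (0 : EuclideanSpace ℝ (Fin n)) 1 → (x : M) → TangentSpace (𝓡 n) x),
        IsControlSystem F ψ X →
        ∀ p ∈ slitCotangentOver U, p.1 ∈ ψ.source → extendedGeodesicField X p = {ξ p} := by
  have := hτ.isLinear
  have hφτ : φ.source = τ.baseSet := by rw [hφU, hτ.baseSet_eq]
  have hX₀ := isControlSystem_radialControl hτ hφ hφU hC2.toIsHorizontallyC1Family
  have hdiff : ∀ y, DifferentiableOn ℝ (fun x => inTrivialization F τ φ (x, y) ^ 2) φ.target :=
    fun y => (hC2.differentiableOn y).pow 2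
  have hconv : ∀ x₀ ∈ φ.target, ∃ c, ∀ᶠ x in 𝓝 x₀,
      IsStronglyConvexNorm c (fun y => inTrivialization F τ φ (x, y)) := fun x₀ hx₀ =>
    hFG.exists_isStronglyConvexNorm hG hφτ hC2.toIsHorizontallyC1Family hx₀
  have hiff : ∀ (p₀ p : CotangentBundle n M) (ψ : OpenPartialHomeomorph M _)
      (X : Metric.sphere (0 : EuclideanSpace ℝ (Fin n)) 1 → (x : M) → TangentSpace (𝓡 n) x),
      IsControlSystem F ψ X → p ∈ slitCotangentOver U → p.1 ∈ ψ.source →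
      p ∈ (extChartAt (cotI n) p₀).source → ∀ ξ, ξ ∈ extendedGeodesicField X p ↔
        mvfderiv (cotI n) (extChartAt (cotI n) p₀) p ξ =
          geodesicFieldInChart F τ φ p₀ (extChartAt (cotI n) p₀ p) := by
    intro p₀ p ψ X hX hpU hpψ hp ξ
    obtain ⟨c, hc⟩ := hconv (φ p.1) (φ.map_source (by rw [hφU]; exact hpU.1))
    exact mem_extendedGeodesicField_iff hτ hφ hφU hdiff hLip.continuousOn hX hpU hpψ hp
      hc.self_of_nhds ξ
  have hUopen : IsOpen U := hφU ▸ φ.open_source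
  refine ⟨fun x hx => ⟨φ, _, hφU.symm ▸ hx, hX₀⟩, geodesicField F τ φ, fun p₀ hp₀ => ?_,
    fun ψ X hX p hp hpψ => ?_⟩
  · have hχ : chartAt (EuclideanSpace ℝ (Fin n)) p₀.1 ∈ IsManifold.maximalAtlas (𝓡 n) ∞ M :=
      IsManifold.chart_mem_maximalAtlas p₀.1
    have hs := mem_extChartAt_source (I := cotI n) p₀
    have hs' := mem_extChartAt_cotangent_source.1 hs
    have hz1 := extChartAt_cotangent_fst p₀ p₀
    have hq : (extChartAt (cotI n) p₀ p₀).1 ∈ (chartAt (EuclideanSpace ℝ (Fin n)) p₀.1).target := by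
      rw [hz1]; exact (chartAt _ p₀.1).map_source hs'
    have hqp : (chartAt (EuclideanSpace ℝ (Fin n)) p₀.1).symm (extChartAt (cotI n) p₀ p₀).1 =
        p₀.1 := by
      rw [hz1, (chartAt _ p₀.1).left_inv hs']
    have hφp : p₀.1 ∈ φ.source := by rw [hφU]; exact hp₀.1
    have htD : (φ ∘ (chartAt (EuclideanSpace ℝ (Fin n)) p₀.1).symm)
        (extChartAt (cotI n) p₀ p₀).1 ∈ φ.target := by
      rw [Function.comp_apply, hqp]; exact φ.map_source hφp
    obtain ⟨c, hc⟩ := hconv _ htD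
    have hlip : LipschitzNear (geodesicFieldInChart F τ φ p₀) (extChartAt (cotI n) p₀ p₀) :=
      lipschitzNear_geodesicFieldCoord φ.open_target hdiff hLip
        (contDiffAt_transition hχ hφ hq (by rwa [hqp]))
        (contDiffAt_frameInChart hτ hχ hq (by rw [hqp]; exact hp₀.1)) htD hc
        (extChartAt_cotangent_snd_comp_frameInChart_ne_zero hs' (hφτ ▸ hφp) hp₀.2)
    -- near `p₀` the field is represented in the one chart at `p₀`: at every nearby covector, this
    -- chart and the chart at that covector describe the same extended geodesic field
    refine hlip.congr ?_
    have hcont : ContinuousAt (fun z => ((extChartAt (cotI n) p₀).symm z).1)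
        (extChartAt (cotI n) p₀ p₀) :=
      contMDiff_cotangent_proj.continuous.continuousAt.comp (continuousAt_extChartAt_symm p₀)
    filter_upwards [extChartAt_target_mem_nhds (I := cotI n) p₀,
      hcont (hUopen.mem_nhds (by beta_reduce; rw [extChartAt_to_inv]; exact hp₀.1)),
      continuousAt_snd (isOpen_ne.mem_nhds ((extChartAt_cotangent_snd_ne_zero_iff hs).2 hp₀.2))]
      with z hz hzU hz2
    have hps := (extChartAt (cotI n) p₀).map_target hz
    have hslit : (extChartAt (cotI n) p₀).symm z ∈ slitCotangentOver U :=
      ⟨hzU, (extChartAt_cotangent_snd_ne_zero_iff hps).1 (by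
        rw [(extChartAt (cotI n) p₀).right_inv hz]; exact hz2)⟩
    have hφz : ((extChartAt (cotI n) p₀).symm z).1 ∈ φ.source := by rw [hφU]; exact hzU
    have h1 := (hiff _ _ φ _ hX₀ hslit hφz (mem_extChartAt_source (I := cotI n) _) _).2
      (mvfderiv_geodesicField_self _)
    have h2 := (hiff p₀ _ φ _ hX₀ hslit hφz hps _).1 h1
    rw [(extChartAt (cotI n) p₀).right_inv hz] at h2
    exact h2.symm
  · ext ξ
    have hs := mem_extChartAt_source (I := cotI n) p
    rw [hiff p p ψ X hX hp hpψ hs, mem_singleton_iff, ← mvfderiv_geodesicField_self]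
    exact (bijective_mvfderiv_extChartAt_cotangent hs).1.eq_iff
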